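/- **Model.** There are $n$ nodes, joined pairwise by authenticated asynchronous channels. The adversary schedules all deliveries and local steps, chooses the inputs, may corrupt nodes at any time (at most $t$ in total), and chooses every message of a corrupted (dishonest) node. A common coin with a given identifier returns the same value to all honest nodes that activate it; its value may be arbitrary. An $(n,k)$ error correction code consists of an encoder $w\mapsto(\mathrm{Enc}_1(w),\dots,\mathrm{Enc}_n(w))$ and a decoder $\mathrm{Dec}$ that recovers $w$ from any set of at least $2e+k$ observed symbols of which at most $e$ are wrong. A protocol has *agreement* if in every execution no two honest nodes output different values. **OciorMVBA-RR-IT.** Let $\mathrm{Predicate}$ be a $\{\mathrm{true},\mathrm{false}\}$-valued function on messages, let an $(n,t+1)$ code be given, and let $\Pi$ be a multi-valued asynchronous Byzantine agreement (ABA) protocol whose outputs are messages or a default value $\bot$. Node $i$, on an input $w_i$ with $\mathrm{Predicate}(w_i)=\mathrm{true}$, runs the following. 1. *Dispersal.* Send SHARE$(\mathrm{Enc}_j(w_i))$ to each node $j$. On the first SHARE$(y)$ from node $j$, record $S[j]=y$ and answer VOTE. After $n-t$ VOTEs, send ELECTION to all. After $n-t$ ELECTIONs or $t+1$ CONFIRMs,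 send CONFIRM to all (once). After $2t+1$ CONFIRMs, send CONFIRM if this was not done, and return the record $S$ (unset entries are $\bot$). 2. *Rounds $r=1,\dots,n$.* - Obtain $\ell\in\{1,\dots,n\}$ from the common coin of round $r$. - Send ECHO$(\ell,S[\ell])$ to all, wait for ECHO$(\ell,\cdot)$ messages from $n-t$ nodes, and decode them to $\bar w$. - Call instance $\ell$ of $\Pi$ with input $\bar w$, and let $\hat w$ be its output. If $\ell$ was elected before, the output of the existing instance is used. - If $\hat w\neq\bot$ and $\mathrm{Predicate}(\hat w)=\mathrm{true}$, output $\hat w$ and terminate; otherwise go to the next round. **The ABA protocol $\Pi_0$** (coded exchange with one binary agreement). Let $k=\lfloor t/5\rfloor+1$ and let an $(n,k)$ code be given. Node $i$ with input $w_i$ sends $(\mathrm{Enc}_j(w_i),\mathrm{Enc}_i(w_i))$ to each node $j$. Node $j$ is *linked* (*unlinked*) at $i$ if the pair received from $j$ equals (differs from) $(\mathrm{Enc}_i(w_i),\mathrm{Enc}_j(w_i))$. - Node $i$ sends to all a first indicator: $1$ once $n-2t$ nodes are linked, or $0$ once $t+1$ nodes are unlinked (whichever is done first). - For each phase of indicators,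 a node *succeeds* at $i$ if it sent $1$ and is linked, and *fails* at $i$ if it sent $0$, or sent $1$ and is unlinked. - Node $i$ sends to all a second indicator: $1$ if its first indicator is $1$ and $n-2t$ nodes succeed in the first phase; $0$ if its first indicator is $0$ or $t+1$ nodes fail in the first phase. - Node $i$ inputs into a binary agreement $1$ once $n-2t$ nodes succeed in the second phase, or $0$ once $t+1$ nodes fail in it. - If the binary agreement outputs $0$, output $\bot$. If it outputs $1$ and the second indicator of $i$ is $1$, output $w_i$. If it outputs $1$ and the second indicator of $i$ is $0$: wait until the pairs received from $t+1$ nodes that sent second indicator $1$ have the same first entry $y$, and send $y$ to all as a corrected symbol; then, from the own symbols of the nodes that sent second indicator $1$ and the corrected symbols of the others, decode $w$, and output $w$ once at least $k+t$ of these symbols agree with $\mathrm{Enc}(w)$. The binary agreement is the Mostéfaoui–Moumen–Raynal protocol, with one common coin bit per round. In round $r$ a node does the following. - It sends BVAL$(r,\mathit{est})$, relays BVAL$(r,b)$ after $t+1$ copies, and accepts $b$ in round $r$ after $2t+1$ copies. - It sends AUX$(r,b)$ for one accepted $b$, and waits for AUX messages of $n-t$ nodes all of whose values are accepted. Let $V$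 be the set of these values and $s$ the coin of the round. - If $V=\{b\}$, then $\mathit{est}:=b$, and if moreover $b=s$ it sends FINISH$(b)$ (at most one FINISH is sent); otherwise $\mathit{est}:=s$. FINISH$(b)$ is relayed after $t+1$ copies, and after $2t+1$ copies a node outputs $b$ and terminates. **Theorem (Agreement).** Let $n\ge 5t+1$. In OciorMVBA-RR-IT with $\Pi=\Pi_0$, if two honest nodes output $\boldsymbol w'$ and $\boldsymbol w''$, respectively, then $\boldsymbol w'=\boldsymbol w''$. More generally, the same holds with any protocol $\Pi$ that itself has agreement in the presence of at most $t$ dishonest nodes. -/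

import Mathlib

/-! ## Asynchronous message-passing protocols with common coins and an adaptive adversary -/

/-- Number of nodes with a given property. -/
noncomputable def nodeCount {n : ℕ} (P : Fin n → Prop) : ℕ := by
  classical exact (Finset.univ.filter P).card

/-- What can trigger an atomic step of an honest node: the arrival of its input, the arrival of a
message over the (authenticated) channel from a node, the return of a common coin that the node has
activated, or nothing external (an enabled local rule is executed). -/
inductive NodeEvent (n : ℕ) (I Msg CoinId : Type) (CoinVal : CoinId → Type) : Type where
  | input (v : I)
  | recv (sender : Fin n) (m : Msg)
  | coin (id : CoinId) (v : CoinVal id)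
  | tau

/-- What a node does in an atomic step, apart from changing its state: it sends messages (given as
pairs of a destination and a content), activates common coins and possibly outputs a value. -/
structure Effects (n : ℕ) (O Msg CoinId : Type) : Type where
  sends : List (Fin n × Msg) := []
  toss : List CoinId := []
  out : Option O := none

/-- The same message for each of the `n` nodes. -/
def toAll {n : ℕ} {Msg : Type} (m : Msg) : List (Fin n × Msg) :=
  (List.finRange n).map fun j => (j, m)

/-- A protocol for `n` nodes with inputs in `I` and outputs in `O`: the program that the honest
nodes run. `step i s ev s' e` says that in state `s`, on the event `ev`, node `i` may move to the
state `s'` with the effects `e`. A message whose handler is not enabled just stays in its channel. -/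
structure Protocol (n : ℕ) (I O : Type) : Type 1 where
  Msg : Type
  State : Type
  CoinId : Type
  CoinVal : CoinId → Type
  init : State
  step : Fin n → State → NodeEvent n I Msg CoinId CoinVal → State → Effects n O Msg CoinId → Prop

/-- A global configuration. -/
structure Config {n : ℕ} {I O : Type} (P : Protocol n I O) : Type where
  /-- local states -/
  state : Fin n → P.State
  /-- messages in transit: sender, receiver, content -/
  net : Multiset (Fin n × Fin n × P.Msg)
  /-- coins activated by a node and not yet returned to it -/
  pending : Multiset (Fin n × P.CoinId)
  /-- inputs received so far -/
  inputs : Fin n → Option I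
  /-- values output so far, with the node that has output them -/
  outs : Multiset (Fin n × O)
  /-- the dishonest nodes -/
  corrupted : Finset (Fin n)

namespace Config

variable {n : ℕ} {I O : Type} {P : Protocol n I O}

/-- The initial configuration. -/
def start (P : Protocol n I O) : Config P where
  state := fun _ => P.init
  net := 0
  pending := 0
  inputs := fun _ => none
  outs := 0
  corrupted := ∅

/-- Node `p` moves to the state `s` with the effects `e`. -/
def commit (c : Config P) (p : Fin n) (s : P.State) (e : Effects n O P.Msg P.CoinId) : Config P :=
  { c with
    state := Function.update c.state p s
    net := c.net + Multiset.ofList (e.sends.map fun x => (p, x.1, x.2))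
    pending := c.pending + Multiset.ofList (e.toss.map fun id => (p, id))
    outs := c.outs + Multiset.ofList (e.out.toList.map fun v => (p, v)) }

end Config

/-- One step of an execution in which at most `t` nodes are ever corrupted. The order of the steps
(hence the delay of every message), the inputs, the corruptions, which may happen at any time, and
all the messages of dishonest nodes are up to the adversary. The ideal common coin `coin` returns
the same value to all nodes that activate it; nothing is assumed about the values of the coins or
about what the adversary knows of them. -/
inductive ExecStep {n : ℕ} {I O : Type} (P : Protocol n I O) (t : ℕ)
    (coin : (id : P.CoinId) → P.CoinVal id) : Config P → Config P → Prop where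
  | input (c : Config P) (p : Fin n) (v : I) (s : P.State) (e : Effects n O P.Msg P.CoinId)
      (hp : p ∉ c.corrupted) (hin : c.inputs p = none)
      (hs : P.step p (c.state p) (.input v) s e) :
      ExecStep P t coin c
        (Config.commit { c with inputs := Function.update c.inputs p (some v) } p s e)
  | deliver (c : Config P) (p q : Fin n) (m : P.Msg) (rest : Multiset (Fin n × Fin n × P.Msg))
      (s : P.State) (e : Effects n O P.Msg P.CoinId)
      (hp : p ∉ c.corrupted) (hm : c.net = (q, p, m) ::ₘ rest)
      (hs : P.step p (c.state p) (.recv q m) s e) :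
      ExecStep P t coin c (Config.commit { c with net := rest } p s e)
  | forge (c : Config P) (p q : Fin n) (m : P.Msg)
      (s : P.State) (e : Effects n O P.Msg P.CoinId)
      (hp : p ∉ c.corrupted) (hq : q ∈ c.corrupted)
      (hs : P.step p (c.state p) (.recv q m) s e) :
      ExecStep P t coin c (Config.commit c p s e)
  | coin (c : Config P) (p : Fin n) (id : P.CoinId) (rest : Multiset (Fin n × P.CoinId))
      (s : P.State) (e : Effects n O P.Msg P.CoinId)
      (hp : p ∉ c.corrupted) (hm : c.pending = (p, id) ::ₘ rest)
      (hs : P.step p (c.state p) (.coin id (coin id)) s e) :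
      ExecStep P t coin c (Config.commit { c with pending := rest } p s e)
  | tau (c : Config P) (p : Fin n) (s : P.State) (e : Effects n O P.Msg P.CoinId)
      (hp : p ∉ c.corrupted) (hs : P.step p (c.state p) .tau s e) :
      ExecStep P t coin c (Config.commit c p s e)
  | corrupt (c : Config P) (p : Fin n) (ht : (insert p c.corrupted).card ≤ t) :
      ExecStep P t coin c { c with corrupted := insert p c.corrupted }

/-- The configurations that occur in executions with at most `t` dishonest nodes. -/
def Reachable {n : ℕ} {I O : Type} (P : Protocol n I O) (t : ℕ)
    (coin : (id : P.CoinId) → P.CoinVal id) (c : Config P) : Prop :=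
  Relation.ReflTransGen (ExecStep P t coin) (Config.start P) c

/-- In every execution with at most `t` dishonest nodes, whatever the values of the common coins,
no two honest nodes output different values. -/
def Agreement {n : ℕ} {I O : Type} (P : Protocol n I O) (t : ℕ) : Prop :=
  ∀ (coin : (id : P.CoinId) → P.CoinVal id) (c : Config P), Reachable P t coin c →
    ∀ (p q : Fin n) (u v : O), p ∉ c.corrupted → q ∉ c.corrupted →
      (p, u) ∈ c.outs → (q, v) ∈ c.outs → u = v

/-! ## Error correction codes -/

/-- An `(n, k)` error correction code for messages in `W` with symbols in `A`: the decoder, applied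
to the symbols observed at some of the `n` positions, corrects `e` errors whenever at least
`2 e + k` symbols are observed (as for Reed-Solomon codes). -/
structure ECC (n k : ℕ) (W A : Type) : Type where
  enc : W → Fin n → A
  dec : (Fin n → Option A) → W
  dec_correct : ∀ (w : W) (obs : Fin n → Option A) (e : ℕ),
    2 * e + k ≤ nodeCount (fun j => ∃ y, obs j = some y) →
    nodeCount (fun j => ∃ y, obs j = some y ∧ y ≠ enc w j) ≤ e →
    dec obs = w

/-! ## Asynchronous binary Byzantine agreement

The signature-free protocol of Mostéfaoui, Moumen and Raynal with one common coin per round, closed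
by an amplification step after which a node outputs and terminates. -/

namespace ABBA

inductive Msg : Type where
  | bval (r : ℕ) (b : Bool)
  | aux (r : ℕ) (b : Bool)
  | finish (b : Bool)

structure State (n : ℕ) : Type where
  /-- current round and estimate, once the input has arrived -/
  cur : Option (ℕ × Bool) := none
  bvalSent : Finset (ℕ × Bool) := ∅
  bvalRecv : Finset (ℕ × Bool × Fin n) := ∅
  binVals : Finset (ℕ × Bool) := ∅
  auxSent : Finset ℕ := ∅
  auxRecv : Finset (ℕ × Bool × Fin n) := ∅
  /-- the set of values collected in the current round, while its coin is awaited -/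
  vals : Option (Finset Bool) := none
  finishSent : Bool := false
  finishRecv : Finset (Bool × Fin n) := ∅
  halted : Bool := false

/-- The coin of round `r` is a bit. -/
abbrev Ev (n : ℕ) : Type := NodeEvent n Bool Msg ℕ (fun _ => Bool)

abbrev Eff (n : ℕ) : Type := Effects n Bool Msg ℕ

inductive Step (n t : ℕ) : State n → Ev n → State n → Eff n → Prop where
  | input (s : State n) (b : Bool) (h : s.halted = false) (hc : s.cur = none) :
      Step n t s (.input b)
        { s with cur := some (0, b), bvalSent := insert (0, b) s.bvalSent }
        { sends := toAll (.bval 0 b) }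
  | recvBval (s : State n) (j : Fin n) (r : ℕ) (b : Bool) (h : s.halted = false) :
      Step n t s (.recv j (.bval r b)) { s with bvalRecv := insert (r, b, j) s.bvalRecv } {}
  | recvAux (s : State n) (j : Fin n) (r : ℕ) (b : Bool) (h : s.halted = false)
      (hfirst : ∀ b', (r, b', j) ∉ s.auxRecv) :
      Step n t s (.recv j (.aux r b)) { s with auxRecv := insert (r, b, j) s.auxRecv } {}
  | recvFinish (s : State n) (j : Fin n) (b : Bool) (h : s.halted = false)
      (hfirst : ∀ b', (b', j) ∉ s.finishRecv) :
      Step n t s (.recv j (.finish b)) { s with finishRecv := insert (b, j) s.finishRecv } {}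
  | relayBval (s : State n) (r : ℕ) (b : Bool) (h : s.halted = false)
      (hn : t + 1 ≤ nodeCount fun j => (r, b, j) ∈ s.bvalRecv) (hs : (r, b) ∉ s.bvalSent) :
      Step n t s .tau { s with bvalSent := insert (r, b) s.bvalSent }
        { sends := toAll (.bval r b) }
  | addBin (s : State n) (r : ℕ) (b : Bool) (h : s.halted = false)
      (hn : 2 * t + 1 ≤ nodeCount fun j => (r, b, j) ∈ s.bvalRecv) :
      Step n t s .tau { s with binVals := insert (r, b) s.binVals } {}
  | sendAux (s : State n) (r : ℕ) (est b : Bool) (h : s.halted = false)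
      (hc : s.cur = some (r, est)) (hb : (r, b) ∈ s.binVals) (hs : r ∉ s.auxSent) :
      Step n t s .tau { s with auxSent := insert r s.auxSent } { sends := toAll (.aux r b) }
  /-- `V` is the set of the values of `aux` messages of at least `n - t` nodes -/
  | collect (s : State n) (r : ℕ) (est : Bool) (Q : Finset (Fin n)) (V : Finset Bool)
      (h : s.halted = false) (hc : s.cur = some (r, est)) (hv : s.vals = none)
      (hs : r ∈ s.auxSent) (hQ : n - t ≤ Q.card)
      (hQV : ∀ j ∈ Q, ∃ b ∈ V, (r, b, j) ∈ s.auxRecv)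
      (hVQ : ∀ b ∈ V, ∃ j ∈ Q, (r, b, j) ∈ s.auxRecv)
      (hbin : ∀ b ∈ V, (r, b) ∈ s.binVals) :
      Step n t s .tau { s with vals := some V } { toss := [r] }
  | coinMixed (s : State n) (r : ℕ) (est : Bool) (V : Finset Bool) (b : Bool)
      (h : s.halted = false) (hc : s.cur = some (r, est)) (hv : s.vals = some V)
      (hV : ∀ b', V ≠ {b'}) :
      Step n t s (.coin r b)
        { s with cur := some (r + 1, b), vals := none,
                 bvalSent := insert (r + 1, b) s.bvalSent }
        { sends := toAll (.bval (r + 1) b) }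
  | coinMiss (s : State n) (r : ℕ) (est b b' : Bool)
      (h : s.halted = false) (hc : s.cur = some (r, est)) (hv : s.vals = some {b})
      (hb : b' ≠ b) :
      Step n t s (.coin r b')
        { s with cur := some (r + 1, b), vals := none,
                 bvalSent := insert (r + 1, b) s.bvalSent }
        { sends := toAll (.bval (r + 1) b) }
  | coinHit (s : State n) (r : ℕ) (est b : Bool)
      (h : s.halted = false) (hc : s.cur = some (r, est)) (hv : s.vals = some {b}) :
      Step n t s (.coin r b)
        { s with cur := some (r + 1, b), vals := none, finishSent := true,
                 bvalSent := insert (r + 1, b) s.bvalSent }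
        { sends := (if s.finishSent = true then [] else toAll (.finish b)) ++
            toAll (.bval (r + 1) b) }
  | relayFinish (s : State n) (b : Bool) (h : s.halted = false)
      (hn : t + 1 ≤ nodeCount fun j => (b, j) ∈ s.finishRecv) (hs : s.finishSent = false) :
      Step n t s .tau { s with finishSent := true } { sends := toAll (.finish b) }
  | output (s : State n) (b : Bool) (h : s.halted = false)
      (hn : 2 * t + 1 ≤ nodeCount fun j => (b, j) ∈ s.finishRecv) (hs : s.finishSent = true) :
      Step n t s .tau { s with halted := true } { out := some b }

/-- The binary Byzantine agreement protocol. -/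
def protocol (n t : ℕ) : Protocol n Bool Bool where
  Msg := Msg
  State := State n
  CoinId := ℕ
  CoinVal := fun _ => Bool
  init := {}
  step := fun _ => Step n t

end ABBA

/-! ## Multi-valued asynchronous Byzantine agreement for `n ≥ 5 t + 1`

Coded symbols of an `(n, ⌊t/5⌋ + 1)` code are exchanged and two phases of success indicators are
computed from them; one binary agreement decides whether the nodes that succeeded in both phases
keep their message, in which case the other nodes correct their own coded symbol by the majority
rule and decode the message with online error correction, or whether all nodes output the default
value `none`. -/

namespace LiChen

/-- Dimension of the code. -/
def dim (t : ℕ) : ℕ := t / 5 + 1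

inductive Msg (A : Type) : Type where
  /-- `symbol y z` from node `j` to node `i` carries the `i`-th and the `j`-th coded symbol of the
  message of node `j` -/
  | symbol (y z : A)
  | si1 (b : Bool)
  | si2 (b : Bool)
  | correct (y : A)
  | abba (m : ABBA.Msg)

structure State (n : ℕ) (W A : Type) : Type where
  /-- the input message -/
  msg : Option W := none
  symRecv : Fin n → Option (A × A) := fun _ => none
  si1Sent : Option Bool := none
  si1Recv : Fin n → Option Bool := fun _ => none
  si2Sent : Option Bool := none
  si2Recv : Fin n → Option Bool := fun _ => none
  /-- the input to the binary agreement has been given -/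
  voted : Bool := false
  abba : ABBA.State n := {}
  abbaOut : Option Bool := none
  correctSent : Bool := false
  correctRecv : Fin n → Option A := fun _ => none
  halted : Bool := false

variable {n : ℕ} {W A : Type}

/-- At node `i`, the coded symbols received from node `j` match those of the own message. -/
def Linked {k : ℕ} (code : ECC n k W A) (i : Fin n) (s : State n W A) (j : Fin n) : Prop :=
  ∃ w, s.msg = some w ∧ s.symRecv j = some (code.enc w i, code.enc w j)

/-- At node `i`, the coded symbols received from node `j` do not match those of the own message. -/
def Unlinked {k : ℕ} (code : ECC n k W A) (i : Fin n) (s : State n W A) (j : Fin n) : Prop :=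
  ∃ w yz, s.msg = some w ∧ s.symRecv j = some yz ∧ yz ≠ (code.enc w i, code.enc w j)

/-- Node `j` reported success in the phase with received indicators `si`, and is linked. -/
def Succ {k : ℕ} (code : ECC n k W A) (i : Fin n) (s : State n W A) (si : Fin n → Option Bool)
    (j : Fin n) : Prop :=
  si j = some true ∧ Linked code i s j

/-- Node `j` reported failure in the phase with received indicators `si`, or reported success but
is not linked. -/
def Fail {k : ℕ} (code : ECC n k W A) (i : Fin n) (s : State n W A) (si : Fin n → Option Bool)
    (j : Fin n) : Prop :=
  si j = some false ∨ (si j = some true ∧ Unlinked code i s j)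

/-- The symbols available for decoding: the own symbols of the nodes that reported success in the
second phase, and the corrected symbols of other nodes. -/
def symbols (s : State n W A) (j : Fin n) : Option A :=
  if s.si2Recv j = some true ∧ (s.symRecv j).isSome then (s.symRecv j).map Prod.snd
  else s.correctRecv j

abbrev Ev (n : ℕ) (W A : Type) : Type := NodeEvent n W (Msg A) ℕ (fun _ => Bool)

abbrev Eff (n : ℕ) (W A : Type) : Type := Effects n (Option W) (Msg A) ℕ

/-- The effects of a step of the binary agreement, as effects of the calling protocol. -/
def lift (e : ABBA.Eff n) : Eff n W A where
  sends := e.sends.map fun x => (x.1, .abba x.2)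
  toss := e.toss

/-- The state after a step of the binary agreement. -/
def withABBA (s : State n W A) (a : ABBA.State n) (e : ABBA.Eff n) : State n W A :=
  { s with abba := a, abbaOut := e.out.or s.abbaOut }

inductive Step (n t : ℕ) {W A : Type} (code : ECC n (dim t) W A) (i : Fin n) :
    State n W A → Ev n W A → State n W A → Eff n W A → Prop where
  | input (s : State n W A) (w : W) (h : s.halted = false) (hw : s.msg = none) :
      Step n t code i s (.input w) { s with msg := some w }
        { sends := (List.finRange n).map fun j => (j, .symbol (code.enc w j) (code.enc w i)) }
  | recvSymbol (s : State n W A) (j : Fin n) (y z : A) (h : s.halted = false)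
      (hfirst : s.symRecv j = none) :
      Step n t code i s (.recv j (.symbol y z))
        { s with symRecv := Function.update s.symRecv j (some (y, z)) } {}
  | recvSi1 (s : State n W A) (j : Fin n) (b : Bool) (h : s.halted = false)
      (hfirst : s.si1Recv j = none) :
      Step n t code i s (.recv j (.si1 b))
        { s with si1Recv := Function.update s.si1Recv j (some b) } {}
  | recvSi2 (s : State n W A) (j : Fin n) (b : Bool) (h : s.halted = false)
      (hfirst : s.si2Recv j = none) :
      Step n t code i s (.recv j (.si2 b))
        { s with si2Recv := Function.update s.si2Recv j (some b) } {}
  | recvCorrect (s : State n W A) (j : Fin n) (y : A) (h : s.halted = false)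
      (hfirst : s.correctRecv j = none) :
      Step n t code i s (.recv j (.correct y))
        { s with correctRecv := Function.update s.correctRecv j (some y) } {}
  | si1One (s : State n W A) (h : s.halted = false) (hs : s.si1Sent = none)
      (hn : n - 2 * t ≤ nodeCount (Linked code i s)) :
      Step n t code i s .tau { s with si1Sent := some true } { sends := toAll (.si1 true) }
  | si1Zero (s : State n W A) (h : s.halted = false) (hs : s.si1Sent = none)
      (hn : t + 1 ≤ nodeCount (Unlinked code i s)) :
      Step n t code i s .tau { s with si1Sent := some false } { sends := toAll (.si1 false) }
  | si2One (s : State n W A) (h : s.halted = false) (hs : s.si2Sent = none)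
      (h1 : s.si1Sent = some true) (hn : n - 2 * t ≤ nodeCount (Succ code i s s.si1Recv)) :
      Step n t code i s .tau { s with si2Sent := some true } { sends := toAll (.si2 true) }
  | si2Zero (s : State n W A) (h : s.halted = false) (hs : s.si2Sent = none)
      (hn : s.si1Sent = some false ∨ t + 1 ≤ nodeCount (Fail code i s s.si1Recv)) :
      Step n t code i s .tau { s with si2Sent := some false } { sends := toAll (.si2 false) }
  | voteOne (s : State n W A) (a : ABBA.State n) (e : ABBA.Eff n) (h : s.halted = false)
      (hv : s.voted = false) (hn : n - 2 * t ≤ nodeCount (Succ code i s s.si2Recv))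
      (ha : (ABBA.protocol n t).step i s.abba (.input true) a e) :
      Step n t code i s .tau { withABBA s a e with voted := true } (lift e)
  | voteZero (s : State n W A) (a : ABBA.State n) (e : ABBA.Eff n) (h : s.halted = false)
      (hv : s.voted = false) (hn : t + 1 ≤ nodeCount (Fail code i s s.si2Recv))
      (ha : (ABBA.protocol n t).step i s.abba (.input false) a e) :
      Step n t code i s .tau { withABBA s a e with voted := true } (lift e)
  | abbaRecv (s : State n W A) (j : Fin n) (m : ABBA.Msg) (a : ABBA.State n) (e : ABBA.Eff n)
      (h : s.halted = false) (ha : (ABBA.protocol n t).step i s.abba (.recv j m) a e) :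
      Step n t code i s (.recv j (.abba m)) (withABBA s a e) (lift e)
  | abbaCoin (s : State n W A) (r : ℕ) (b : Bool) (a : ABBA.State n) (e : ABBA.Eff n)
      (h : s.halted = false) (ha : (ABBA.protocol n t).step i s.abba (.coin r b) a e) :
      Step n t code i s (.coin r b) (withABBA s a e) (lift e)
  | abbaTau (s : State n W A) (a : ABBA.State n) (e : ABBA.Eff n)
      (h : s.halted = false) (ha : (ABBA.protocol n t).step i s.abba .tau a e) :
      Step n t code i s .tau (withABBA s a e) (lift e)
  | outputDefault (s : State n W A) (w : W) (h : s.halted = false) (ha : s.abbaOut = some false)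
      (hw : s.msg = some w) :
      Step n t code i s .tau { s with halted := true } { out := some none }
  | outputOwn (s : State n W A) (w : W) (h : s.halted = false) (ha : s.abbaOut = some true)
      (h2 : s.si2Sent = some true) (hw : s.msg = some w) :
      Step n t code i s .tau { s with halted := true } { out := some (some w) }
  /-- majority rule for the own coded symbol -/
  | sendCorrect (s : State n W A) (y : A) (h : s.halted = false) (ha : s.abbaOut = some true)
      (h2 : s.si2Sent = some false) (hs : s.correctSent = false)
      (hn : t + 1 ≤ nodeCount fun j => s.si2Recv j = some true ∧ ∃ z, s.symRecv j = some (y, z)) :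
      Step n t code i s .tau { s with correctSent := true } { sends := toAll (.correct y) }
  /-- online error correction -/
  | outputDecoded (s : State n W A) (v w : W) (h : s.halted = false) (ha : s.abbaOut = some true)
      (hv : s.msg = some v) (h2 : s.si2Sent = some false) (hs : s.correctSent = true)
      (hw : w = code.dec (symbols s))
      (hn : dim t + t ≤ nodeCount fun j => symbols s j = some (code.enc w j)) :
      Step n t code i s .tau { s with halted := true } { out := some (some w) }

/-- The multi-valued Byzantine agreement protocol. -/
def protocol (n t : ℕ) {W A : Type} (code : ECC n (dim t) W A) : Protocol n W (Option W) where
  Msg := Msg A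
  State := State n W A
  CoinId := ℕ
  CoinVal := fun _ => Bool
  init := {}
  step := Step n t code

end LiChen

/-! ## OciorMVBA-RR-IT -/

namespace MVBARR

inductive Msg (n : ℕ) (A M : Type) : Type where
  /-- dispersal -/
  | share (y : A)
  | vote
  | election
  | confirm
  /-- retrieval of the message dispersed by node `l` -/
  | echo (l : Fin n) (y : Option A)
  /-- Byzantine agreement instance `l` -/
  | aba (l : Fin n) (m : M)

/-- Control location in the main program. -/
inductive Loc (n : ℕ) : Type where
  /-- no (valid) input yet -/
  | idle
  /-- in the dispersal subprotocol -/
  | dispersing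
  /-- round `r`: waiting for the election -/
  | electing (r : ℕ)
  /-- round `r`: in data retrieval for the elected node `l` -/
  | retrieving (r : ℕ) (l : Fin n)
  /-- round `r`: waiting for the Byzantine agreement instance `l` -/
  | agreeing (r : ℕ) (l : Fin n)
  /-- the loop has been left after the last round without output -/
  | exhausted
  /-- output and terminated -/
  | terminated

structure State (n : ℕ) (W A S : Type) : Type where
  loc : Loc n
  /-- dispersal: shares received so far -/
  shares : Fin n → Option A
  voteRecv : Finset (Fin n)
  electionSent : Bool
  electionRecv : Finset (Fin n)
  confirmSent : Bool
  confirmRecv : Finset (Fin n)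
  /-- the share record returned by the dispersal -/
  record : Fin n → Option A
  /-- `echoRecv l j`: the symbol received from node `j` in the retrieval for node `l` -/
  echoRecv : Fin n → Fin n → Option (Option A)
  /-- instances of the Byzantine agreement: local states, inputs given, outputs -/
  aba : Fin n → S
  abaStarted : Finset (Fin n)
  abaOut : Fin n → Option (Option W)

variable {n : ℕ} {W A : Type}

/-- The dispersal subprotocol has not returned yet. -/
def Dispersal {S : Type} (s : State n W A S) : Prop :=
  s.loc = .idle ∨ s.loc = .dispersing

/-- Common coins: one election per round, with values in the set of nodes, and the coins of the
Byzantine agreement instances. -/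
abbrev CoinId (aba : Protocol n W (Option W)) : Type := ℕ ⊕ (Fin n × aba.CoinId)

abbrev CoinVal (aba : Protocol n W (Option W)) : CoinId aba → Type :=
  Sum.elim (fun _ => Fin n) (fun x => aba.CoinVal x.2)

abbrev Ev (A : Type) (aba : Protocol n W (Option W)) : Type :=
  NodeEvent n W (Msg n A aba.Msg) (CoinId aba) (CoinVal aba)

abbrev Eff (A : Type) (aba : Protocol n W (Option W)) : Type :=
  Effects n W (Msg n A aba.Msg) (CoinId aba)

/-- The effects of a step of the agreement instance `l`, as effects of the calling protocol. -/
def lift (aba : Protocol n W (Option W)) (l : Fin n)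
    (e : Effects n (Option W) aba.Msg aba.CoinId) : Eff A aba where
  sends := e.sends.map fun x => (x.1, .aba l x.2)
  toss := e.toss.map fun id => .inr (l, id)

/-- The state after a step of the agreement instance `l`. -/
def withABA (aba : Protocol n W (Option W)) (s : State n W A aba.State) (l : Fin n)
    (a : aba.State) (e : Effects n (Option W) aba.Msg aba.CoinId) : State n W A aba.State :=
  { s with
    aba := Function.update s.aba l a
    abaOut := Function.update s.abaOut l (e.out.or (s.abaOut l)) }

inductive Step (n t : ℕ) {W A : Type} (pred : W → Bool) (code : ECC n (t + 1) W A)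
    (aba : Protocol n W (Option W)) (i : Fin n) :
    State n W A aba.State → Ev A aba → State n W A aba.State → Eff A aba → Prop where
  /- The dispersal subprotocol. -/
  | input (s : State n W A aba.State) (w : W) (h : s.loc = .idle) (hw : pred w = true) :
      Step n t pred code aba i s (.input w) { s with loc := .dispersing }
        { sends := (List.finRange n).map fun j => (j, .share (code.enc w j)) }
  | recvShare (s : State n W A aba.State) (j : Fin n) (y : A) (h : Dispersal s)
      (hfirst : s.shares j = none) :
      Step n t pred code aba i s (.recv j (.share y))
        { s with shares := Function.update s.shares j (some y) } { sends := [(j, .vote)] }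
  | recvVote (s : State n W A aba.State) (j : Fin n) (h : Dispersal s) :
      Step n t pred code aba i s (.recv j .vote)
        { s with voteRecv := insert j s.voteRecv } {}
  | recvElection (s : State n W A aba.State) (j : Fin n) (h : Dispersal s) :
      Step n t pred code aba i s (.recv j .election)
        { s with electionRecv := insert j s.electionRecv } {}
  | recvConfirm (s : State n W A aba.State) (j : Fin n) (h : Dispersal s) :
      Step n t pred code aba i s (.recv j .confirm)
        { s with confirmRecv := insert j s.confirmRecv } {}
  | sendElection (s : State n W A aba.State) (h : Dispersal s)
      (hs : s.electionSent = false) (hn : n - t ≤ s.voteRecv.card) :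
      Step n t pred code aba i s .tau { s with electionSent := true }
        { sends := toAll .election }
  | sendConfirm (s : State n W A aba.State) (h : Dispersal s) (hs : s.confirmSent = false)
      (hn : n - t ≤ s.electionRecv.card ∨ t + 1 ≤ s.confirmRecv.card) :
      Step n t pred code aba i s .tau { s with confirmSent := true } { sends := toAll .confirm }
  /- The dispersal returns the share record, and the first election is called. -/
  | disperseReturn (s : State n W A aba.State) (h : s.loc = .dispersing)
      (hn : 2 * t + 1 ≤ s.confirmRecv.card) :
      Step n t pred code aba i s .tau
        { s with loc := .electing 1, confirmSent := true, record := s.shares }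
        { sends := if s.confirmSent = true then [] else toAll .confirm, toss := [.inl 1] }
  /- The election of round `r` returns `l`, for the first time: data retrieval is called. -/
  | elected (s : State n W A aba.State) (r : ℕ) (l : Fin n) (h : s.loc = .electing r)
      (hl : l ∉ s.abaStarted) :
      Step n t pred code aba i s (.coin (.inl r) l) { s with loc := .retrieving r l }
        { sends := toAll (.echo l (s.record l)) }
  /- The election returns a node that was elected before: the instance with this identifier
  exists already, and its output is used again. -/
  | electedAgain (s : State n W A aba.State) (r : ℕ) (l : Fin n) (h : s.loc = .electing r)
      (hl : l ∈ s.abaStarted) :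
      Step n t pred code aba i s (.coin (.inl r) l) { s with loc := .agreeing r l } {}
  | recvEcho (s : State n W A aba.State) (j l : Fin n) (y : Option A) (h : s.loc ≠ .terminated)
      (hfirst : s.echoRecv l j = none) :
      Step n t pred code aba i s (.recv j (.echo l y))
        { s with echoRecv := Function.update s.echoRecv l
                  (Function.update (s.echoRecv l) j (some y)) } {}
  /- Data retrieval decodes, and the agreement instance `l` is called with the result. -/
  | retrieved (s : State n W A aba.State) (r : ℕ) (l : Fin n) (w : W) (a : aba.State)
      (e : Effects n (Option W) aba.Msg aba.CoinId) (h : s.loc = .retrieving r l)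
      (hn : n - t ≤ nodeCount fun j => (s.echoRecv l j).isSome)
      (hw : w = code.dec fun j => (s.echoRecv l j).join)
      (ha : aba.step i (s.aba l) (.input w) a e) :
      Step n t pred code aba i s .tau
        { withABA aba s l a e with
          loc := .agreeing r l, abaStarted := insert l s.abaStarted }
        (lift aba l e)
  /- Steps of the agreement instances. -/
  | abaRecv (s : State n W A aba.State) (j l : Fin n) (m : aba.Msg) (a : aba.State)
      (e : Effects n (Option W) aba.Msg aba.CoinId) (h : s.loc ≠ .terminated)
      (ha : aba.step i (s.aba l) (.recv j m) a e) :
      Step n t pred code aba i s (.recv j (.aba l m)) (withABA aba s l a e) (lift aba l e)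
  | abaCoin (s : State n W A aba.State) (l : Fin n) (id : aba.CoinId) (v : aba.CoinVal id)
      (a : aba.State) (e : Effects n (Option W) aba.Msg aba.CoinId) (h : s.loc ≠ .terminated)
      (ha : aba.step i (s.aba l) (.coin id v) a e) :
      Step n t pred code aba i s (.coin (.inr (l, id)) v) (withABA aba s l a e) (lift aba l e)
  | abaTau (s : State n W A aba.State) (l : Fin n) (a : aba.State)
      (e : Effects n (Option W) aba.Msg aba.CoinId) (h : s.loc ≠ .terminated)
      (ha : aba.step i (s.aba l) .tau a e) :
      Step n t pred code aba i s .tau (withABA aba s l a e) (lift aba l e)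
  /- The agreement instance has an output, and the predicate is checked. -/
  | output (s : State n W A aba.State) (r : ℕ) (l : Fin n) (w : W) (h : s.loc = .agreeing r l)
      (ho : s.abaOut l = some (some w)) (hw : pred w = true) :
      Step n t pred code aba i s .tau { s with loc := .terminated } { out := some w }
  | nextRound (s : State n W A aba.State) (r : ℕ) (l : Fin n) (o : Option W)
      (h : s.loc = .agreeing r l) (ho : s.abaOut l = some o)
      (hw : ∀ w, o = some w → pred w = false) (hr : r < n) :
      Step n t pred code aba i s .tau { s with loc := .electing (r + 1) }
        { toss := [.inl (r + 1)] }
  | lastRound (s : State n W A aba.State) (r : ℕ) (l : Fin n) (o : Option W)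
      (h : s.loc = .agreeing r l) (ho : s.abaOut l = some o)
      (hw : ∀ w, o = some w → pred w = false) (hr : r = n) :
      Step n t pred code aba i s .tau { s with loc := .exhausted } {}

/-- OciorMVBA-RR-IT with external predicate `pred`, dispersal code `code`, and `aba` as the
protocol run in the Byzantine agreement instances. -/
def protocol (n t : ℕ) {W A : Type} (pred : W → Bool) (code : ECC n (t + 1) W A)
    (aba : Protocol n W (Option W)) : Protocol n W W where
  Msg := Msg n A aba.Msg
  State := State n W A aba.State
  CoinId := CoinId aba
  CoinVal := CoinVal aba
  init :=
    { loc := .idle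
      shares := fun _ => none
      voteRecv := ∅
      electionSent := false
      electionRecv := ∅
      confirmSent := false
      confirmRecv := ∅
      record := fun _ => none
      echoRecv := fun _ _ => none
      aba := fun _ => aba.init
      abaStarted := ∅
      abaOut := fun _ => none }
  step := Step n t pred code aba

end MVBARR

/-! Both claims reduce to one reduction: OciorMVBA-RR-IT has agreement as soon as the protocol in
its instances has it. For each `l`, what instance `l` does inside an execution of the caller is
itself an execution of the instance protocol with the same dishonest nodes
(`Subprotocol.View.execStep`), so honest nodes never get different outputs from one instance. The
election coin sends all honest nodes to the same instance in round `r`. If one of them outputs a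
valid message in round `r`, an honest node that went beyond round `r` would have got an invalid
output from that instance. Hence honest nodes output in the same round, from the same instance
(`MVBARR.agreement`). Nothing about dispersal or retrieval enters.

It remains to prove agreement of the concrete protocol (`LiChen.agreement`). By the same reduction,
the bit of the binary agreement decides between a message and the default value. Agreement of that
bit (`ABBA.agreement`) is the usual argument: once a singleton `{b}` is collected in a round whose
coin is `b`, quorum intersection makes `b` the only estimate of all later rounds.

The core is that honest nodes with second indicator `1` hold the same message. By
`LiChen.card_group_lt`, the message of such a node is held by strictly more honest nodes than any
other message, and two messages cannot both be so. This is a double count of linked pairs; it uses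
that code words of different messages agree in at most `⌊t/5⌋` places. A decoded output agrees with
the unique kept message in `k` symbols, hence equals it.

Corruption is adaptive, so invariants are stated for a fixed set `F` containing all nodes ever
corrupted; in the end `F` is the final corrupted set, and nodes of `F` are distrusted from the
start. -/

/-! ## Executions -/

section Executions

variable {n : ℕ} {I O : Type} {P : Protocol n I O}

/-- `Consumes coin c p ev c₀`: in the configuration `c` the event `ev` may happen at node `p`, and
`c₀` is what remains of `c` once the event is consumed. -/
inductive Consumes (coin : (id : P.CoinId) → P.CoinVal id) (c : Config P) (p : Fin n) :
    NodeEvent n I P.Msg P.CoinId P.CoinVal → Config P → Prop where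
  | input (v : I) (hin : c.inputs p = none) :
      Consumes coin c p (.input v) { c with inputs := Function.update c.inputs p (some v) }
  | deliver (q : Fin n) (m : P.Msg) (rest : Multiset (Fin n × Fin n × P.Msg))
      (hm : c.net = (q, p, m) ::ₘ rest) : Consumes coin c p (.recv q m) { c with net := rest }
  | forge (q : Fin n) (m : P.Msg) (hq : q ∈ c.corrupted) : Consumes coin c p (.recv q m) c
  | coin (id : P.CoinId) (rest : Multiset (Fin n × P.CoinId)) (hm : c.pending = (p, id) ::ₘ rest) :
      Consumes coin c p (.coin id (coin id)) { c with pending := rest }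
  | tau : Consumes coin c p .tau c

theorem ExecStep.of_consumes {t : ℕ} {coin : (id : P.CoinId) → P.CoinVal id} {c c₀ : Config P}
    {p : Fin n} {ev : NodeEvent n I P.Msg P.CoinId P.CoinVal} {s : P.State}
    {e : Effects n O P.Msg P.CoinId} (hp : p ∉ c.corrupted) (hc : Consumes coin c p ev c₀)
    (hs : P.step p (c.state p) ev s e) : ExecStep P t coin c (c₀.commit p s e) := by
  cases hc with
  | input v hin => exact .input c p v s e hp hin hs
  | deliver q m rest hm => exact .deliver c p q m rest s e hp hm hs
  | forge q m hq => exact .forge c p q m s e hp hq hs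
  | coin id rest hm => exact .coin c p id rest s e hp hm hs
  | tau => exact .tau c p s e hp hs

/-- Gives all non-corruption steps one shape, consume an event and then commit, so that invariants
need not distinguish how the event arose. -/
theorem ExecStep.consumes_or_corrupt {t : ℕ} {coin : (id : P.CoinId) → P.CoinVal id}
    {c c' : Config P} (h : ExecStep P t coin c c') :
    (∃ p ev c₀ s e, p ∉ c.corrupted ∧ Consumes coin c p ev c₀ ∧ P.step p (c.state p) ev s e ∧
      c' = c₀.commit p s e) ∨
    ∃ p, (insert p c.corrupted).card ≤ t ∧ c' = { c with corrupted := insert p c.corrupted } := by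
  cases h with
  | input p v s e hp hin hs => exact .inl ⟨p, _, _, s, e, hp, .input v hin, hs, rfl⟩
  | deliver p q m rest s e hp hm hs => exact .inl ⟨p, _, _, s, e, hp, .deliver q m rest hm, hs, rfl⟩
  | forge p q m s e hp hq hs => exact .inl ⟨p, _, _, s, e, hp, .forge q m hq, hs, rfl⟩
  | coin p id rest s e hp hm hs => exact .inl ⟨p, _, _, s, e, hp, .coin id rest hm, hs, rfl⟩
  | tau p s e hp hs => exact .inl ⟨p, _, _, s, e, hp, .tau, hs, rfl⟩
  | corrupt p ht => exact .inr ⟨p, ht, rfl⟩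

namespace Consumes

variable {coin : (id : P.CoinId) → P.CoinVal id} {c c₀ : Config P} {p : Fin n}
  {ev : NodeEvent n I P.Msg P.CoinId P.CoinVal}

theorem state_eq (h : Consumes coin c p ev c₀) : c₀.state = c.state := by cases h <;> rfl

theorem outs_eq (h : Consumes coin c p ev c₀) : c₀.outs = c.outs := by cases h <;> rfl

theorem corrupted_eq (h : Consumes coin c p ev c₀) : c₀.corrupted = c.corrupted := by
  cases h <;> rfl

theorem net_le (h : Consumes coin c p ev c₀) : c₀.net ≤ c.net := by
  cases h with
  | deliver q m rest hm => rw [hm]; exact Multiset.le_cons_self _ _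
  | _ => exact le_rfl

theorem coin_eq (h : Consumes coin c p ev c₀) (id : P.CoinId) (v : P.CoinVal id)
    (hev : ev = .coin id v) : v = coin id := by
  cases h with
  | coin => cases hev; rfl
  | _ => cases hev

theorem sender (h : Consumes coin c p ev c₀) (q : Fin n) (m : P.Msg) (hev : ev = .recv q m) :
    q ∈ c.corrupted ∨ (q, p, m) ∈ c.net := by
  cases h with
  | deliver q m rest hm => cases hev; exact .inr (by rw [hm]; exact Multiset.mem_cons_self _ _)
  | forge q m hq => cases hev; exact .inl hq
  | _ => cases hev

end Consumes

namespace Config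

variable {c : Config P} {p : Fin n} {s : P.State} {e : Effects n O P.Msg P.CoinId}

theorem mem_commit_net {q r : Fin n} {m : P.Msg} :
    (q, r, m) ∈ (c.commit p s e).net ↔ (q, r, m) ∈ c.net ∨ q = p ∧ (r, m) ∈ e.sends := by
  simp [commit, eq_comm, and_comm]

theorem mem_commit_outs {q : Fin n} {v : O} :
    (q, v) ∈ (c.commit p s e).outs ↔ (q, v) ∈ c.outs ∨ q = p ∧ e.out = some v := by
  simp [commit, eq_comm, and_comm]

end Config

theorem ExecStep.outs_mono {t : ℕ} {coin : (id : P.CoinId) → P.CoinVal id} {c c' : Config P}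
    (h : ExecStep P t coin c c') {x : Fin n × O} (hx : x ∈ c.outs) : x ∈ c'.outs := by
  obtain ⟨p, ev, c₀, s, e, -, hc, -, rfl⟩ | ⟨p, -, rfl⟩ := h.consumes_or_corrupt
  · exact Config.mem_commit_outs.2 (.inl (hc.outs_eq ▸ hx))
  · exact hx

theorem ExecStep.corrupted_subset {t : ℕ} {coin : (id : P.CoinId) → P.CoinVal id} {c c' : Config P}
    (h : ExecStep P t coin c c') : c.corrupted ⊆ c'.corrupted := by
  obtain ⟨p, ev, c₀, s, e, -, hc, -, rfl⟩ | ⟨p, -, rfl⟩ := h.consumes_or_corrupt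
  · exact hc.corrupted_eq.ge
  · exact Finset.subset_insert _ _

theorem Reachable.card_corrupted_le {t : ℕ} {coin : (id : P.CoinId) → P.CoinVal id} {c : Config P}
    (h : Reachable P t coin c) : c.corrupted.card ≤ t := by
  induction h with
  | refl => simp [Config.start]
  | tail _ hs ih =>
    obtain ⟨p, ev, c₀, s, e, -, hc, -, rfl⟩ | ⟨p, ht, rfl⟩ := hs.consumes_or_corrupt
    · exact hc.corrupted_eq ▸ ih
    · exact ht

/-- To prove an invariant of the nodes outside a set `F` of nodes that contains all the nodes that
are corrupted in an execution, it suffices to consider the steps of single nodes. -/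
theorem Reachable.invariant {t : ℕ} {coin : (id : P.CoinId) → P.CoinVal id} {F : Finset (Fin n)}
    {Inv : Config P → Prop} (h₀ : Inv (Config.start P))
    (hcorrupt : ∀ c F', Inv c → Inv { c with corrupted := F' })
    (hstep : ∀ c p ev c₀ s e, Inv c → c.corrupted ⊆ F → Consumes coin c p ev c₀ →
      P.step p (c.state p) ev s e → Inv (c₀.commit p s e))
    {c : Config P} (h : Reachable P t coin c) (hF : c.corrupted ⊆ F) : Inv c := by
  induction h with
  | refl => exact h₀
  | tail _ hs ih =>
    -- Corruption only grows, so a bound `F` at the end also bounds every earlier configuration.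
    have ih := ih (hs.corrupted_subset.trans hF)
    have hF' := hs.corrupted_subset.trans hF
    obtain ⟨p, ev, c₀, s, e, hp, hc, hst, rfl⟩ | ⟨p, ht, rfl⟩ := hs.consumes_or_corrupt
    · exact hstep _ p ev c₀ s e ih hF' hc hst
    · exact hcorrupt _ _ ih

end Executions

/-! ## Executions of subprotocols -/

section Subprotocols

variable {n : ℕ} {I O I' O' : Type}

/-- A way to find an instance of the protocol `Q` in the protocol `P`: which messages and coins
belong to the instance, and its local state, whether it has received its input, and its output. -/
structure Subprotocol (P : Protocol n I O) (Q : Protocol n I' O') where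
  msg : P.Msg → Option Q.Msg
  coinId : P.CoinId → Option Q.CoinId
  state : P.State → Q.State
  started : P.State → Prop
  out : P.State → Option O'

namespace Subprotocol

variable {P : Protocol n I O} {Q : Protocol n I' O'} (E : Subprotocol P Q)

def sends (l : List (Fin n × P.Msg)) : List (Fin n × Q.Msg) :=
  l.filterMap fun x => (E.msg x.2).map fun m => (x.1, m)

def net (N : Multiset (Fin n × Fin n × P.Msg)) : Multiset (Fin n × Fin n × Q.Msg) :=
  N.filterMap fun x => (E.msg x.2.2).map fun m => (x.1, x.2.1, m)

def pending (N : Multiset (Fin n × P.CoinId)) : Multiset (Fin n × Q.CoinId) :=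
  N.filterMap fun x => (E.coinId x.2).map fun id => (x.1, id)

/-- The event does not concern the instance. -/
def Foreign : NodeEvent n I P.Msg P.CoinId P.CoinVal → Prop
  | .recv _ m => E.msg m = none
  | .coin id _ => E.coinId id = none
  | _ => True

/-- The step does not concern the instance. -/
structure Idle (s : P.State) (ev : NodeEvent n I P.Msg P.CoinId P.CoinVal) (s' : P.State)
    (e : Effects n O P.Msg P.CoinId) : Prop where
  foreign : E.Foreign ev
  state_eq : E.state s' = E.state s
  out_eq : E.out s' = E.out s
  started : E.started s → E.started s'
  sends_eq : E.sends e.sends = []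
  toss_eq : e.toss.filterMap E.coinId = []

/-- The event of the instance that corresponds to an event at the node; `fresh` says that the
instance has not received its input. -/
inductive Corresponds (coin : (id : Q.CoinId) → Q.CoinVal id) (fresh : Prop) :
    NodeEvent n I P.Msg P.CoinId P.CoinVal → NodeEvent n I' Q.Msg Q.CoinId Q.CoinVal → Prop where
  | input (v : I') (h : fresh) : Corresponds coin fresh .tau (.input v)
  | recv (j : Fin n) (m : P.Msg) (m' : Q.Msg) (h : E.msg m = some m') :
      Corresponds coin fresh (.recv j m) (.recv j m')
  | coin (id : P.CoinId) (v : P.CoinVal id) (id' : Q.CoinId) (h : E.coinId id = some id') :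
      Corresponds coin fresh (.coin id v) (.coin id' (coin id'))
  | tau : Corresponds coin fresh .tau .tau

/-- The step is a step of the instance. -/
structure Active (coin : (id : Q.CoinId) → Q.CoinVal id) (p : Fin n) (s : P.State)
    (ev : NodeEvent n I P.Msg P.CoinId P.CoinVal) (s' : P.State) (e : Effects n O P.Msg P.CoinId)
    (ev' : NodeEvent n I' Q.Msg Q.CoinId Q.CoinVal) (e' : Effects n O' Q.Msg Q.CoinId) : Prop where
  corresponds : E.Corresponds coin (¬ E.started s) ev ev'
  step : Q.step p (E.state s) ev' (E.state s') e'
  out_eq : E.out s' = e'.out.or (E.out s)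
  started : E.started s → E.started s'
  started_of_input : ∀ v, ev' = .input v → E.started s'
  sends_eq : E.sends e.sends = e'.sends
  toss_eq : e.toss.filterMap E.coinId = e'.toss

/-- The configuration `d` of `Q` is what one sees of the instance in the configuration `c`. -/
structure View (c : Config P) (d : Config Q) : Prop where
  state_eq : ∀ p, d.state p = E.state (c.state p)
  net_eq : d.net = E.net c.net
  pending_eq : d.pending = E.pending c.pending
  corrupted_eq : d.corrupted = c.corrupted
  -- This and the next clause are implications only: the caller does not store the input it gave,
  -- and it may overwrite a recorded output by a later one.
  inputs_eq : ∀ p, ¬ E.started (c.state p) → d.inputs p = none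
  outs : ∀ p v, E.out (c.state p) = some v → (p, v) ∈ d.outs

variable {E}

/-! ### Following an instance along an execution of its caller. -/

theorem view_start (hinit : E.state P.init = Q.init) (hout : E.out P.init = none) :
    E.View (Config.start P) (Config.start Q) where
  state_eq _ := hinit.symm
  net_eq := rfl
  pending_eq := rfl
  corrupted_eq := rfl
  inputs_eq _ _ := rfl
  outs p v h := by simp [Config.start, hout] at h

theorem sends_map_eq_nil {α : Type} (f : α → Fin n × P.Msg) (h : ∀ a, E.msg (f a).2 = none)
    (l : List α) : E.sends (l.map f) = [] := by
  simp [sends, h, List.filterMap_map]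

theorem sends_map_self (g : Q.Msg → P.Msg) (h : ∀ m, E.msg (g m) = some m)
    (l : List (Fin n × Q.Msg)) : E.sends (l.map fun x => (x.1, g x.2)) = l := by
  simp [sends, h, List.filterMap_map]

theorem toss_map_eq_nil {α : Type} (f : α → P.CoinId) (h : ∀ a, E.coinId (f a) = none)
    (l : List α) : (l.map f).filterMap E.coinId = [] := by
  simp [h, List.filterMap_map]

theorem toss_map_self (g : Q.CoinId → P.CoinId) (h : ∀ id, E.coinId (g id) = some id)
    (l : List Q.CoinId) : (l.map g).filterMap E.coinId = l := by
  simp [h, List.filterMap_map]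

theorem net_add (N : Multiset (Fin n × Fin n × P.Msg)) (p : Fin n) (l : List (Fin n × P.Msg)) :
    E.net (N + Multiset.ofList (l.map fun x => (p, x.1, x.2))) =
      E.net N + Multiset.ofList ((E.sends l).map fun x => (p, x.1, x.2)) := by
  simp only [net, sends, Multiset.filterMap_add, Multiset.filterMap_coe, List.filterMap_map,
    List.map_filterMap]
  congr 3
  funext x
  simp [Function.comp_def]

theorem pending_add (N : Multiset (Fin n × P.CoinId)) (p : Fin n) (l : List P.CoinId) :
    E.pending (N + Multiset.ofList (l.map fun id => (p, id))) =
      E.pending N + Multiset.ofList ((l.filterMap E.coinId).map fun id => (p, id)) := by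
  simp only [pending, Multiset.filterMap_add, Multiset.filterMap_coe, List.filterMap_map,
    List.map_filterMap]
  congr 3

/-- Whatever is consumed, sent or tossed in a foreign step is erased by the projections, so the
instance need not move. -/
theorem View.idle {coin : (id : P.CoinId) → P.CoinVal id} {c c₀ : Config P} {d : Config Q}
    {p : Fin n} {ev : NodeEvent n I P.Msg P.CoinId P.CoinVal} {s : P.State}
    {e : Effects n O P.Msg P.CoinId} (hv : E.View c d) (hc : Consumes coin c p ev c₀)
    (h : E.Idle (c.state p) ev s e) : E.View (c₀.commit p s e) d := by
  have hnet : E.net c₀.net = E.net c.net := by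
    cases hc with
    | deliver q m rest hm =>
      have : E.msg m = none := h.foreign
      simp [net, hm, this]
    | _ => rfl
  have hpend : E.pending c₀.pending = E.pending c.pending := by
    cases hc with
    | coin id rest hm =>
      have : E.coinId id = none := h.foreign
      simp [pending, hm, this]
    | _ => rfl
  have hst : ∀ q, E.state ((c₀.commit p s e).state q) = E.state (c.state q) ∧
      E.out ((c₀.commit p s e).state q) = E.out (c.state q) ∧
      (E.started (c.state q) → E.started ((c₀.commit p s e).state q)) := by
    intro q
    by_cases hq : q = p
    · subst hq
      simpa [Config.commit] using ⟨h.state_eq, h.out_eq, h.started⟩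
    · simp [Config.commit, hq, hc.state_eq]
  refine ⟨fun q => ?_, ?_, ?_, ?_, fun q hq => ?_, fun q v hq => ?_⟩
  · rw [hv.state_eq, (hst q).1]
  · simp only [Config.commit, net_add, h.sends_eq, hnet, hv.net_eq]; simp
  · simp only [Config.commit, pending_add, h.toss_eq, hpend, hv.pending_eq]; simp
  · exact hv.corrupted_eq.trans hc.corrupted_eq.symm
  · exact hv.inputs_eq q fun hs => hq ((hst q).2.2 hs)
  · exact hv.outs q v ((hst q).2.1 ▸ hq)

/-- The projection of a multiset with a relevant element removed is the projected multiset with its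
image removed; forged messages stay forged because the corrupted sets coincide. -/
theorem View.consumes {coin : (id : P.CoinId) → P.CoinVal id}
    {coin' : (id : Q.CoinId) → Q.CoinVal id} {c c₀ : Config P} {d : Config Q} {p : Fin n}
    {ev : NodeEvent n I P.Msg P.CoinId P.CoinVal}
    {ev' : NodeEvent n I' Q.Msg Q.CoinId Q.CoinVal} (hv : E.View c d)
    (hc : Consumes coin c p ev c₀) (h : E.Corresponds coin' (¬ E.started (c.state p)) ev ev') :
    ∃ d₀, Consumes coin' d p ev' d₀ ∧ d₀.net = E.net c₀.net ∧ d₀.pending = E.pending c₀.pending ∧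
      ∀ q, d₀.inputs q = d.inputs q ∨ q = p ∧ ∃ v, ev' = .input v := by
  cases h with
  | input v hs =>
    -- The caller feeds the instance in a local step, so nothing is consumed in `c`; freshness
    -- provides the empty input slot in `d`.
    cases hc
    refine ⟨_, .input v (hv.inputs_eq p hs), hv.net_eq, hv.pending_eq, fun q => ?_⟩
    by_cases hq : q = p
    · exact .inr ⟨hq, v, rfl⟩
    · exact .inl (by simp [hq])
  | recv j m m' hm' =>
    cases hc with
    | deliver q m rest hm =>
      refine ⟨_, .deliver j m' (E.net rest) ?_, rfl, hv.pending_eq, fun q => .inl rfl⟩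
      rw [hv.net_eq, hm, net, Multiset.filterMap_cons_some (b := (j, p, m')) _ _ _ (by simp [hm'])]
      rfl
    | forge q m hq =>
      exact ⟨_, .forge j m' (hv.corrupted_eq ▸ hq), hv.net_eq, hv.pending_eq, fun q => .inl rfl⟩
  | coin id v id' hid =>
    cases hc with
    | coin id rest hm =>
      refine ⟨_, .coin id' (E.pending rest) ?_, hv.net_eq, rfl, fun q => .inl rfl⟩
      rw [hv.pending_eq, hm, pending, Multiset.filterMap_cons_some (b := (p, id')) _ _ _
        (by simp [hid])]
      rfl
  | tau =>
    cases hc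
    exact ⟨_, .tau, hv.net_eq, hv.pending_eq, fun q => .inl rfl⟩

theorem View.active {t : ℕ} {coin : (id : P.CoinId) → P.CoinVal id}
    {coin' : (id : Q.CoinId) → Q.CoinVal id} {c c₀ : Config P} {d : Config Q} {p : Fin n}
    {ev : NodeEvent n I P.Msg P.CoinId P.CoinVal} {s : P.State} {e : Effects n O P.Msg P.CoinId}
    {ev' : NodeEvent n I' Q.Msg Q.CoinId Q.CoinVal} {e' : Effects n O' Q.Msg Q.CoinId}
    (hv : E.View c d) (hp : p ∉ c.corrupted) (hc : Consumes coin c p ev c₀)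
    (h : E.Active coin' p (c.state p) ev s e ev' e') :
    ∃ d', ExecStep Q t coin' d d' ∧ E.View (c₀.commit p s e) d' := by
  obtain ⟨d₀, hd, hnet, hpend, hin⟩ := hv.consumes hc h.corresponds
  refine ⟨d₀.commit p (E.state s) e', .of_consumes (hv.corrupted_eq ▸ hp) hd
    (hv.state_eq p ▸ h.step), fun q => ?_, ?_, ?_, ?_, fun q hq => ?_, fun q v hq => ?_⟩
  · by_cases hq : q = p
    · subst hq; simp [Config.commit]
    · simp [Config.commit, hq, hc.state_eq, hd.state_eq, hv.state_eq]
  · simp only [Config.commit, net_add, h.sends_eq, hnet]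
  · simp only [Config.commit, pending_add, h.toss_eq, hpend]
  · exact hd.corrupted_eq.trans (hv.corrupted_eq.trans hc.corrupted_eq.symm)
  · by_cases hqp : q = p
    · subst hqp
      have hq : ¬ E.started s := by simpa [Config.commit] using hq
      obtain h' | ⟨-, v, h'⟩ := hin q
      · exact h'.trans (hv.inputs_eq q fun hs => hq (h.started hs))
      · exact absurd (h.started_of_input v h') hq
    · obtain h' | ⟨h', -⟩ := hin q
      · refine h'.trans (hv.inputs_eq q ?_)
        simpa [Config.commit, hqp, hc.state_eq] using hq
      · exact absurd h' hqp
  · rw [Config.mem_commit_outs, hd.outs_eq]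
    by_cases hqp : q = p
    · subst hqp
      have hq : E.out s = some v := by simpa [Config.commit] using hq
      -- A recorded output is either produced by this very step or was recorded, hence present in
      -- `d.outs`, before.
      rw [h.out_eq, Option.or_eq_some_iff] at hq
      obtain hq | ⟨-, hq⟩ := hq
      · exact .inr ⟨rfl, hq⟩
      · exact .inl (hv.outs _ _ hq)
    · exact .inl (hv.outs _ _ (by simpa [Config.commit, hqp, hc.state_eq] using hq))

/-- The instance follows the steps of an execution of the calling protocol. -/
theorem View.execStep {t : ℕ} {coin : (id : P.CoinId) → P.CoinVal id}
    {coin' : (id : Q.CoinId) → Q.CoinVal id}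
    (hE : ∀ p s ev s' e, P.step p s ev s' e → (∀ id v, ev = .coin id v → v = coin id) →
      E.Idle s ev s' e ∨ ∃ ev' e', E.Active coin' p s ev s' e ev' e')
    {c c' : Config P} {d : Config Q} (hv : E.View c d) (h : ExecStep P t coin c c')
    (hd : Reachable Q t coin' d) :
    ∃ d', Reachable Q t coin' d' ∧ E.View c' d' ∧ ∀ x ∈ d.outs, x ∈ d'.outs := by
  obtain ⟨p, ev, c₀, s, e, hp, hc, hs, rfl⟩ | ⟨p, ht, rfl⟩ := h.consumes_or_corrupt
  · obtain hi | ⟨ev', e', ha⟩ := hE _ _ _ _ _ hs hc.coin_eq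
    · exact ⟨d, hd, hv.idle hc hi, fun _ h => h⟩
    · obtain ⟨d', hs', hv'⟩ := hv.active (t := t) hp hc ha
      exact ⟨d', hd.tail hs', hv', fun x hx => hs'.outs_mono hx⟩
  · have hs' : ExecStep Q t coin' d { d with corrupted := insert p d.corrupted } :=
      .corrupt d p (hv.corrupted_eq ▸ ht)
    exact ⟨_, hd.tail hs', ⟨hv.state_eq, hv.net_eq, hv.pending_eq,
      congrArg (insert p) hv.corrupted_eq, hv.inputs_eq, hv.outs⟩, fun _ h => h⟩

end Subprotocol

end Subprotocols

/-! ## Agreement of OciorMVBA-RR-IT -/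

namespace MVBARR

variable {n t : ℕ} {W A : Type} {pred : W → Bool} {code : ECC n (t + 1) W A}
  {aba : Protocol n W (Option W)}

/-- The instance `l` of the Byzantine agreement. -/
def abaInstance (t : ℕ) (pred : W → Bool) (code : ECC n (t + 1) W A)
    (aba : Protocol n W (Option W)) (l : Fin n) :
    Subprotocol (protocol n t pred code aba) aba where
  msg m := match m with
    | .aba l' m' => if l' = l then some m' else none
    | _ => none
  coinId id := match id with
    | .inl _ => none
    | .inr x => if x.1 = l then some x.2 else none
  state s := s.aba l
  -- The second conjunct makes freshness at the step `retrieved` visible from the control location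
  -- alone, without an invariant linking `loc` and `abaStarted`. It cannot destroy `started`, since
  -- retrieval for `l` is entered only when `l ∉ abaStarted`.
  started s := l ∈ s.abaStarted ∧ ∀ r, s.loc ≠ .retrieving r l
  out s := s.abaOut l

theorem sends_lift_self (l : Fin n) (e : Effects n (Option W) aba.Msg aba.CoinId) :
    (abaInstance t pred code aba l).sends (lift (A := A) aba l e).sends = e.sends :=
  Subprotocol.sends_map_self (P := protocol n t pred code aba) (.aba l) (fun _ => if_pos rfl) _

theorem toss_lift_self (l : Fin n) (e : Effects n (Option W) aba.Msg aba.CoinId) :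
    (lift (A := A) aba l e).toss.filterMap (abaInstance t pred code aba l).coinId = e.toss :=
  Subprotocol.toss_map_self (P := protocol n t pred code aba) (fun id => .inr (l, id))
    (fun _ => if_pos rfl) _

theorem sends_lift_of_ne {l l' : Fin n} (h : l' ≠ l)
    (e : Effects n (Option W) aba.Msg aba.CoinId) :
    (abaInstance t pred code aba l).sends (lift (A := A) aba l' e).sends = [] :=
  Subprotocol.sends_map_eq_nil (P := protocol n t pred code aba) _ (fun _ => if_neg h) _

theorem toss_lift_of_ne {l l' : Fin n} (h : l' ≠ l)
    (e : Effects n (Option W) aba.Msg aba.CoinId) :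
    (lift (A := A) aba l' e).toss.filterMap (abaInstance t pred code aba l).coinId = [] :=
  Subprotocol.toss_map_eq_nil (P := protocol n t pred code aba) _ (fun _ => if_neg h) _

theorem sends_toAll (l : Fin n) (m : Msg n A aba.Msg)
    (h : (abaInstance t pred code aba l).msg m = none) :
    (abaInstance t pred code aba l).sends (toAll m) = [] :=
  Subprotocol.sends_map_eq_nil (P := protocol n t pred code aba) _ (fun _ => h) _

/-- A step of the protocol that changes neither the instances nor the control location. -/
theorem idle_of_eq (l : Fin n) {s s' : State n W A aba.State} {ev : Ev A aba} {e : Eff A aba}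
    (hev : (abaInstance t pred code aba l).Foreign ev) (haba : s'.aba = s.aba)
    (hout : s'.abaOut = s.abaOut) (hst : s'.abaStarted = s.abaStarted)
    (hloc : ∀ r, s'.loc = .retrieving r l → s.loc = .retrieving r l ∨ l ∉ s.abaStarted)
    (hsends : (abaInstance t pred code aba l).sends e.sends = [])
    (htoss : e.toss.filterMap (abaInstance t pred code aba l).coinId = []) :
    (abaInstance t pred code aba l).Idle s ev s' e where
  foreign := hev
  state_eq := congrFun haba l
  out_eq := congrFun hout l
  started h := ⟨hst ▸ h.1, fun r hr => (hloc r hr).elim (h.2 r) fun h' => h' h.1⟩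
  sends_eq := hsends
  toss_eq := htoss

/-- A step of an agreement instance, other than its start, concerns only this instance. -/
theorem idle_or_active_of_lift {coin : (id : CoinId aba) → CoinVal aba id} (l l' : Fin n)
    {p : Fin n} {s : State n W A aba.State} {a : aba.State}
    {e : Effects n (Option W) aba.Msg aba.CoinId} {ev : Ev A aba}
    {ev' : NodeEvent n W aba.Msg aba.CoinId aba.CoinVal}
    (hne : l' ≠ l → (abaInstance t pred code aba l).Foreign ev)
    (hco : ∀ fresh, (abaInstance t pred code aba l').Corresponds (fun id => coin (.inr (l', id)))
      fresh ev ev')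
    (hin : ∀ v, ev' ≠ .input v) (ha : aba.step p (s.aba l') ev' a e) :
    (abaInstance t pred code aba l).Idle s ev (withABA aba s l' a e) (lift aba l' e) ∨
    ∃ ev' e', (abaInstance t pred code aba l).Active (fun id => coin (.inr (l, id))) p s ev
      (withABA aba s l' a e) (lift aba l' e) ev' e' := by
  by_cases hl : l' = l
  · subst hl
    refine .inr ⟨ev', e, hco _, ?_, ?_, fun h => h, fun v hv => absurd hv (hin v),
      sends_lift_self _ _, toss_lift_self _ _⟩
    · simpa [abaInstance, withABA] using ha
    · simp [abaInstance, withABA]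
  · refine .inl ⟨hne hl, ?_, ?_, fun h => h, sends_lift_of_ne hl _, toss_lift_of_ne hl _⟩
    · simp [abaInstance, withABA, Ne.symm hl]
    · simp [abaInstance, withABA, Ne.symm hl]

theorem idle_or_active {coin : (id : CoinId aba) → CoinVal aba id} (l p : Fin n)
    (s : State n W A aba.State) (ev : Ev A aba) (s' : State n W A aba.State) (e : Eff A aba)
    (h : Step n t pred code aba p s ev s' e)
    (hcoin : ∀ id v, ev = .coin id v → v = coin id) :
    (abaInstance t pred code aba l).Idle s ev s' e ∨
    ∃ ev' e', (abaInstance t pred code aba l).Active (fun id => coin (.inr (l, id))) p s ev s' e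
      ev' e' := by
  cases h with
  | input w h hw =>
    refine .inl (idle_of_eq l trivial rfl rfl rfl (by simp) ?_ rfl)
    exact Subprotocol.sends_map_eq_nil (P := protocol n t pred code aba) _ (fun _ => rfl) _
  | recvShare j y h hfirst => exact .inl (idle_of_eq l rfl rfl rfl rfl (fun _ => .inl) rfl rfl)
  | recvVote j h => exact .inl (idle_of_eq l rfl rfl rfl rfl (fun _ => .inl) rfl rfl)
  | recvElection j h => exact .inl (idle_of_eq l rfl rfl rfl rfl (fun _ => .inl) rfl rfl)
  | recvConfirm j h => exact .inl (idle_of_eq l rfl rfl rfl rfl (fun _ => .inl) rfl rfl)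
  | sendElection h hs hn =>
    exact .inl (idle_of_eq l trivial rfl rfl rfl (fun _ => .inl) (sends_toAll l _ rfl) rfl)
  | sendConfirm h hs hn =>
    exact .inl (idle_of_eq l trivial rfl rfl rfl (fun _ => .inl) (sends_toAll l _ rfl) rfl)
  | disperseReturn h hn =>
    refine .inl (idle_of_eq l trivial rfl rfl rfl (by simp) ?_ rfl)
    dsimp only
    split_ifs
    · rfl
    · exact sends_toAll l _ rfl
  | elected r l' h hl =>
    refine .inl (idle_of_eq l rfl rfl rfl rfl (fun r' hr => .inr ?_) (sends_toAll l _ rfl) rfl)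
    cases hr
    exact hl
  | electedAgain r l' h hl => exact .inl (idle_of_eq l rfl rfl rfl rfl (by simp) rfl rfl)
  | recvEcho j l' y h hfirst =>
    exact .inl (idle_of_eq l rfl rfl rfl rfl (fun _ => .inl) rfl rfl)
  | retrieved r l' w a e h hn hw ha =>
    by_cases hl : l' = l
    · subst hl
      refine .inr ⟨.input w, e, .input w fun h' => h'.2 r h, ?_, ?_, fun h' => absurd h (h'.2 r),
        fun v _ => ⟨Finset.mem_insert_self _ _, by simp⟩, sends_lift_self _ _, toss_lift_self _ _⟩
      · simpa [abaInstance, withABA] using ha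
      · simp [abaInstance, withABA]
    · refine .inl ⟨trivial, ?_, ?_, fun h' => ⟨Finset.mem_insert_of_mem h'.1, by simp⟩,
        sends_lift_of_ne hl _, toss_lift_of_ne hl _⟩
      · simp [abaInstance, withABA, Ne.symm hl]
      · simp [abaInstance, withABA, Ne.symm hl]
  | abaRecv j l' m a e h ha =>
    exact idle_or_active_of_lift l l' (fun hl => if_neg hl)
      (fun _ => .recv j _ m (if_pos rfl)) (by simp) ha
  | abaCoin l' id v a e h ha =>
    obtain rfl := hcoin _ _ rfl
    exact idle_or_active_of_lift l l' (fun hl => if_neg hl)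
      (fun _ => .coin _ _ id (if_pos rfl)) (by simp) ha
  | abaTau l' a e h ha =>
    exact idle_or_active_of_lift l l' (fun hl => trivial) (fun _ => .tau) (by simp) ha
  | output r l' w h ho hw => exact .inl (idle_of_eq l trivial rfl rfl rfl (by simp) rfl rfl)
  | nextRound r l' o h ho hw hr =>
    exact .inl (idle_of_eq l trivial rfl rfl rfl (by simp) rfl rfl)
  | lastRound r l' o h ho hw hr =>
    exact .inl (idle_of_eq l trivial rfl rfl rfl (by simp) rfl rfl)

/-! ### Rounds passed and outputs justified by the instances. -/

/-- Node `p` has been through the rounds before `r` without output: in each of them, it has got an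
output that does not satisfy the predicate from the instance of the elected node. -/
def Passed (pred : W → Bool) (elect : ℕ → Fin n) (outs : Fin n → Multiset (Fin n × Option W))
    (p : Fin n) (r : ℕ) : Prop :=
  ∀ r', 1 ≤ r' → r' < r →
    ∃ o, (p, o) ∈ outs (elect r') ∧ ∀ w, o = some w → pred w = false

/-- The round of a control location, with the node elected in this round (if known) the one that
the coin gives, has been reached through all the rounds before. -/
def LocOk (pred : W → Bool) (elect : ℕ → Fin n) (outs : Fin n → Multiset (Fin n × Option W))
    (p : Fin n) : Loc n → Prop
  | .electing r => 1 ≤ r ∧ Passed pred elect outs p r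
  | .retrieving r l | .agreeing r l => 1 ≤ r ∧ l = elect r ∧ Passed pred elect outs p r
  | _ => True

/-- Node `p` may output `u`: the instance of the node elected in some round has output `u`. -/
def OutOk (pred : W → Bool) (elect : ℕ → Fin n) (outs : Fin n → Multiset (Fin n × Option W))
    (p : Fin n) (u : W) : Prop :=
  ∃ r, 1 ≤ r ∧ Passed pred elect outs p r ∧ (p, some u) ∈ outs (elect r) ∧ pred u = true

theorem Passed.mono {elect : ℕ → Fin n} {outs outs' : Fin n → Multiset (Fin n × Option W)}
    {p : Fin n} {r : ℕ} (h : Passed pred elect outs p r) (hsub : ∀ l, ∀ x ∈ outs l, x ∈ outs' l) :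
    Passed pred elect outs' p r := fun r' h₁ h₂ =>
  let ⟨o, ho, hw⟩ := h r' h₁ h₂
  ⟨o, hsub _ _ ho, hw⟩

theorem LocOk.mono {elect : ℕ → Fin n} {outs outs' : Fin n → Multiset (Fin n × Option W)}
    {p : Fin n} {loc : Loc n} (h : LocOk pred elect outs p loc)
    (hsub : ∀ l, ∀ x ∈ outs l, x ∈ outs' l) : LocOk pred elect outs' p loc := by
  cases loc with
  | electing r => exact ⟨h.1, h.2.mono hsub⟩
  | retrieving r l => exact ⟨h.1, h.2.1, h.2.2.mono hsub⟩
  | agreeing r l => exact ⟨h.1, h.2.1, h.2.2.mono hsub⟩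
  | _ => trivial

theorem OutOk.mono {elect : ℕ → Fin n} {outs outs' : Fin n → Multiset (Fin n × Option W)}
    {p : Fin n} {u : W} (h : OutOk pred elect outs p u)
    (hsub : ∀ l, ∀ x ∈ outs l, x ∈ outs' l) : OutOk pred elect outs' p u :=
  let ⟨r, h₁, h₂, h₃, h₄⟩ := h
  ⟨r, h₁, h₂.mono hsub, hsub _ _ h₃, h₄⟩

/-- The election coin is common, so the node elected in round `r` is a function of `r` alone;
leaving a round without output adds that round to those passed. -/
theorem Step.locOk {coin : (id : CoinId aba) → CoinVal aba id} {p : Fin n}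
    {outs : Fin n → Multiset (Fin n × Option W)}
    {s : State n W A aba.State} {ev : Ev A aba} {s' : State n W A aba.State} {e : Eff A aba}
    (h : Step n t pred code aba p s ev s' e)
    (hcoin : ∀ id v, ev = .coin id v → v = coin id)
    (houts : ∀ l o, s.abaOut l = some o → (p, o) ∈ outs l)
    (hloc : LocOk pred (fun r => coin (.inl r)) outs p s.loc) :
    LocOk pred (fun r => coin (.inl r)) outs p s'.loc ∧
      ∀ u, e.out = some u → OutOk pred (fun r => coin (.inl r)) outs p u := by
  cases h with
  | input => exact ⟨trivial, by simp⟩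
  | disperseReturn h hn =>
    -- Rounds are numbered from `1`, so no round precedes the first.
    exact ⟨⟨le_rfl, fun r' h₁ h₂ => absurd h₁ (not_le.2 h₂)⟩, by simp⟩
  | elected r l h hl =>
    rw [h] at hloc
    exact ⟨⟨hloc.1, hcoin _ _ rfl, hloc.2⟩, by simp⟩
  | electedAgain r l h hl =>
    rw [h] at hloc
    exact ⟨⟨hloc.1, hcoin _ _ rfl, hloc.2⟩, by simp⟩
  | retrieved r l w a e h hn hw ha =>
    rw [h] at hloc
    exact ⟨hloc, by simp [lift]⟩
  | abaRecv | abaCoin | abaTau => exact ⟨hloc, by simp [lift]⟩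
  | output r l w h ho hw =>
    rw [h] at hloc
    obtain ⟨h₁, rfl, h₂⟩ := hloc
    refine ⟨trivial, ?_⟩
    rintro u ⟨⟩
    exact ⟨r, h₁, h₂, houts _ _ ho, hw⟩
  | nextRound r l o h ho hw hr =>
    rw [h] at hloc
    obtain ⟨h₁, rfl, h₂⟩ := hloc
    refine ⟨⟨by omega, fun r' h₁' h₂' => ?_⟩, by simp⟩
    obtain h' | rfl := Nat.lt_succ_iff_lt_or_eq.1 h₂'
    · exact h₂ r' h₁' h'
    · exact ⟨o, houts _ _ ho, hw⟩
  | lastRound => exact ⟨trivial, by simp⟩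
  | _ => exact ⟨hloc, by simp⟩

/-- The history of an execution, seen through the executions of the agreement instances. -/
theorem exists_instances {coin : (id : CoinId aba) → CoinVal aba id}
    {c : Config (protocol n t pred code aba)}
    (h : Reachable (protocol n t pred code aba) t coin c) :
    ∃ D : Fin n → Config aba,
      (∀ l, Reachable aba t (fun id => coin (.inr (l, id))) (D l) ∧
        (abaInstance t pred code aba l).View c (D l)) ∧
      (∀ p, LocOk pred (fun r => coin (.inl r)) (fun l => (D l).outs) p (c.state p).loc) ∧
      ∀ p u, (p, u) ∈ c.outs → OutOk pred (fun r => coin (.inl r)) (fun l => (D l).outs) p u := by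
  induction h with
  | refl =>
    exact ⟨fun _ => Config.start aba, fun l => ⟨.refl, Subprotocol.view_start rfl rfl⟩,
      fun p => trivial, fun p u h => by simp [Config.start] at h⟩
  | @tail c c' _ hs ih =>
    obtain ⟨D, hD, hloc, hout⟩ := ih
    -- All instances follow the same step of the caller, and their outputs only accumulate, so the
    -- justifications found earlier survive.
    choose D' hR hV hsub using fun l =>
      (hD l).2.execStep (idle_or_active (coin := coin) l) hs (hD l).1
    refine ⟨D', fun l => ⟨hR l, hV l⟩, ?_⟩
    have hloc' := fun p => (hloc p).mono hsub
    have hout' := fun p u hu => (hout p u hu).mono hsub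
    obtain ⟨p, ev, c₀, s, e, -, hc, hst, rfl⟩ | ⟨p, -, rfl⟩ := hs.consumes_or_corrupt
    · obtain ⟨h₁, h₂⟩ := Step.locOk hst hc.coin_eq
        (fun l o ho => hsub l _ ((hD l).2.outs p o ho)) (hloc' p)
      refine ⟨fun q => ?_, fun q u hu => ?_⟩
      · by_cases hq : q = p
        · subst hq
          simpa [Config.commit] using h₁
        · simpa [Config.commit, hq, hc.state_eq] using hloc' q
      · obtain hu | ⟨rfl, he⟩ := Config.mem_commit_outs.1 hu
        · exact hout' q u (hc.outs_eq ▸ hu)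
        · exact h₂ u he
    · exact ⟨hloc', hout'⟩

/-- Two honest nodes that output must do so in the same round, because neither can have passed the
other's round; agreement of the instance elected there finishes. -/
theorem agreement (h : Agreement aba t) : Agreement (protocol n t pred code aba) t := by
  intro coin c hc p q u v hp hq hu hv
  obtain ⟨D, hD, -, hout⟩ := exists_instances hc
  have hagree : ∀ (l p q : Fin n) (o o' : Option W), p ∉ c.corrupted → q ∉ c.corrupted →
      (p, o) ∈ (D l).outs → (q, o') ∈ (D l).outs → o = o' := fun l p q o o' hp hq =>
    h _ _ (hD l).1 p q o o' ((hD l).2.corrupted_eq ▸ hp) ((hD l).2.corrupted_eq ▸ hq)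
  -- If `p` obtained a valid `u` in round `r`, an honest `q` cannot have passed round `r`: the same
  -- instance would have given it an output that is not valid.
  have hle : ∀ (p q : Fin n) (u : W) (r r' : ℕ), p ∉ c.corrupted → q ∉ c.corrupted → 1 ≤ r →
      (p, some u) ∈ (D (coin (.inl r))).outs → pred u = true →
      Passed pred (fun r => coin (.inl r)) (fun l => (D l).outs) q r' → r' ≤ r := by
    intro p q u r r' hp hq hr hu hpred hpass
    by_contra! hlt
    obtain ⟨o, ho, hw⟩ := hpass r hr hlt
    have := hw u (hagree _ _ _ _ _ hp hq hu ho).symm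
    simp [hpred] at this
  obtain ⟨r, h₁, h₂, h₃, h₄⟩ := hout p u hu
  obtain ⟨r', h₁', h₂', h₃', h₄'⟩ := hout q v hv
  obtain rfl : r = r' := le_antisymm (hle q p v r' r hq hp h₁' h₃' h₄' h₂)
    (hle p q u r r' hp hq h₁ h₃ h₄ h₂')
  exact Option.some.inj (hagree _ _ _ _ _ hp hq h₃ h₃')

end MVBARR

/-! ## Counting nodes -/

theorem nodeCount_eq {n : ℕ} (P : Fin n → Prop) [DecidablePred P] :
    nodeCount P = (Finset.univ.filter P).card := by
  unfold nodeCount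
  congr

theorem nodeCount_mono {n : ℕ} {P Q : Fin n → Prop} (h : ∀ j, P j → Q j) :
    nodeCount P ≤ nodeCount Q := by
  classical
  rw [nodeCount_eq, nodeCount_eq]
  exact Finset.card_le_card (Finset.monotone_filter_right _ fun j _ => h j)

theorem nodeCount_le_add_card {n : ℕ} (P : Fin n → Prop) (F : Finset (Fin n)) :
    nodeCount P ≤ nodeCount (fun j => j ∉ F ∧ P j) + F.card := by
  classical
  rw [nodeCount_eq, nodeCount_eq]
  refine (Finset.card_le_card fun j hj => ?_).trans (Finset.card_union_le _ _)
  by_cases h : j ∈ F <;> simp_all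

theorem exists_of_card_lt_nodeCount {n : ℕ} {P : Fin n → Prop} {F : Finset (Fin n)}
    (h : F.card < nodeCount P) : ∃ j, j ∉ F ∧ P j := by
  classical
  rw [nodeCount_eq] at h
  obtain ⟨j, hj, hF⟩ := Finset.exists_mem_notMem_of_card_lt_card h
  exact ⟨j, hF, (Finset.mem_filter.1 hj).2⟩

/-! ## Agreement of the binary agreement -/

namespace ABBA

variable {n t : ℕ} {coin : ℕ → Bool} {F : Finset (Fin n)}

/-- What the history of an execution has to record: the sets of values that have been collected in
each round by nodes outside `F`, and the `aux` messages sent by each node. -/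
structure History (n : ℕ) : Type where
  collected : ℕ → Finset Bool → Prop
  aux : Fin n → ℕ → Bool → Prop

/-- The value `b` is the estimate of some node outside `F` at the beginning of the round `r`. -/
def Estimate (coin : ℕ → Bool) (X : History n) (r : ℕ) (b : Bool) : Prop :=
  r = 0 ∨ ∃ k V, r = k + 1 ∧ X.collected k V ∧ (V = {b} ∨ (∀ b', V ≠ {b'}) ∧ b = coin k)

/-- Some node outside `F` has sent `finish b` because the coin was right. -/
def Hit (coin : ℕ → Bool) (X : History n) (b : Bool) : Prop :=
  ∃ r, X.collected r {b} ∧ coin r = b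

/-- Collected sets are made of estimates, and come from quorums. -/
structure History.Sound (t : ℕ) (coin : ℕ → Bool) (F : Finset (Fin n)) (X : History n) : Prop where
  quorum : ∀ r V, X.collected r V → ∃ Q : Finset (Fin n), n - t ≤ Q.card ∧
    ∀ j ∈ Q, j ∉ F → ∃ b ∈ V, X.aux j r b
  nonempty : ∀ r V, X.collected r V → V.Nonempty
  estimate : ∀ r V, X.collected r V → ∀ b ∈ V, Estimate coin X r b
  aux_unique : ∀ j ∉ F, ∀ r b b', X.aux j r b → X.aux j r b' → b = b'

/-- Two quorums of `n - t` nodes share at least `n - 2t ≥ t + 1` nodes, hence one outside `F`, and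
it sent a single `aux` value in the round. -/
theorem History.Sound.eq_of_singletons {X : History n} (hX : X.Sound t coin F)
    (hF : F.card ≤ t) (hn : 3 * t + 1 ≤ n) {r : ℕ} {b b' : Bool} (h : X.collected r {b})
    (h' : X.collected r {b'}) : b = b' := by
  classical
  obtain ⟨Q, hQ, hb⟩ := hX.quorum _ _ h
  obtain ⟨Q', hQ', hb'⟩ := hX.quorum _ _ h'
  have h₁ := Finset.card_union_add_card_inter Q Q'
  have h₂ : (Q ∪ Q').card ≤ n := (Finset.card_le_univ _).trans_eq (Fintype.card_fin n)
  obtain ⟨j, hj, hjF⟩ := Finset.exists_mem_notMem_of_card_lt_card (s := F) (t := Q ∩ Q') (by omega)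
  obtain ⟨hj, hj'⟩ := Finset.mem_inter.1 hj
  obtain ⟨x, hx, hx'⟩ := hb j hj hjF
  obtain ⟨y, hy, hy'⟩ := hb' j hj' hjF
  rw [Finset.mem_singleton] at hx hy
  exact hx ▸ hy ▸ hX.aux_unique j hjF _ _ _ hx' hy'

/-- In round `r + 1` an estimate comes from a singleton, which must be `{b}`, or from the coin,
which is `b`. From then on only `b` can be collected, so the coin is never adopted again. -/
theorem History.Sound.estimate_eq {X : History n} (hX : X.Sound t coin F)
    (hF : F.card ≤ t) (hn : 3 * t + 1 ≤ n) {r : ℕ} {b : Bool} (h : X.collected r {b})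
    (hr : coin r = b) {r' : ℕ} (hlt : r < r') : ∀ {b' : Bool}, Estimate coin X r' b' → b' = b := by
  induction r', hlt using Nat.le_induction with
  | base =>
    rintro b' (h' | ⟨_, V, ⟨⟩, hV, rfl | ⟨-, rfl⟩⟩)
    · exact absurd h' (by simp)
    · exact hX.eq_of_singletons hF hn hV h
    · exact hr
  | succ r' _ ih =>
    rintro b' (h' | ⟨_, V, ⟨⟩, hV, h'⟩)
    · exact absurd h' (by simp)
    · have : V = {b} := Finset.eq_singleton_iff_nonempty_unique_mem.2
        ⟨hX.nonempty _ _ hV, fun x hx => ih (hX.estimate _ _ hV x hx)⟩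
      obtain h' | ⟨h', -⟩ := h'
      · exact Finset.singleton_injective (h'.symm.trans this)
      · exact absurd this (h' b)

/-- In one round both values equal the coin; otherwise the value of the later hit was an estimate
after the earlier hit. -/
theorem History.Sound.hit_unique {X : History n} (hX : X.Sound t coin F) (hF : F.card ≤ t)
    (hn : 3 * t + 1 ≤ n) {b b' : Bool} (h : Hit coin X b) (h' : Hit coin X b') : b = b' := by
  obtain ⟨r, hr, hc⟩ := h
  obtain ⟨r', hr', hc'⟩ := h'
  obtain hlt | rfl | hlt := lt_trichotomy r r'
  · exact (hX.estimate_eq hF hn hr hc hlt (hX.estimate _ _ hr' _ (by simp))).symm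
  · exact hc.symm.trans hc'
  · exact hX.estimate_eq hF hn hr' hc' hlt (hX.estimate _ _ hr _ (by simp))

/-- The history justifies a message of a node. -/
def MsgOk (coin : ℕ → Bool) (X : History n) (p : Fin n) : Msg → Prop
  | .bval r b => Estimate coin X r b
  | .aux r b => X.aux p r b
  | .finish b => Hit coin X b

/-- The history justifies the state of a node. -/
structure StateOk (coin : ℕ → Bool) (F : Finset (Fin n)) (X : History n) (p : Fin n)
    (s : State n) : Prop where
  bvalRecv : ∀ r b j, (r, b, j) ∈ s.bvalRecv → j ∉ F → Estimate coin X r b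
  auxRecv : ∀ r b j, (r, b, j) ∈ s.auxRecv → j ∉ F → X.aux j r b
  finishRecv : ∀ b j, (b, j) ∈ s.finishRecv → j ∉ F → Hit coin X b
  binVals : ∀ r b, (r, b) ∈ s.binVals → Estimate coin X r b
  -- This direction, from the history to the state, is what excludes a second `aux` message in a
  -- round.
  auxSent : ∀ r b, X.aux p r b → r ∈ s.auxSent
  vals : ∀ V, s.vals = some V → ∃ r est, s.cur = some (r, est) ∧ X.collected r V

/-- The history `Y` extends `X` by steps of node `p`. -/
structure Extends (p : Fin n) (X Y : History n) : Prop where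
  collected : ∀ r V, X.collected r V → Y.collected r V
  aux : ∀ j r b, X.aux j r b → Y.aux j r b
  aux_of_ne : ∀ j, j ≠ p → ∀ r b, Y.aux j r b → X.aux j r b

theorem Extends.rfl {p : Fin n} {X : History n} : Extends p X X :=
  ⟨fun _ _ h => h, fun _ _ _ h => h, fun _ _ _ _ h => h⟩

theorem Extends.estimate {p : Fin n} {X Y : History n} (h : Extends p X Y) {r : ℕ} {b : Bool}
    (hb : Estimate coin X r b) : Estimate coin Y r b := by
  obtain hb | ⟨r', V, h₁, h₂, h₃⟩ := hb
  · exact .inl hb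
  · exact .inr ⟨r', V, h₁, h.collected _ _ h₂, h₃⟩

theorem Extends.hit {p : Fin n} {X Y : History n} (h : Extends p X Y) {b : Bool}
    (hb : Hit coin X b) : Hit coin Y b :=
  let ⟨r, h₁, h₂⟩ := hb
  ⟨r, h.collected _ _ h₁, h₂⟩

theorem Extends.msgOk {p : Fin n} {X Y : History n} (h : Extends p X Y) {q : Fin n} {m : Msg}
    (hm : MsgOk coin X q m) : MsgOk coin Y q m := by
  cases m with
  | bval r b => exact h.estimate hm
  | aux r b => exact h.aux _ _ _ hm
  | finish b => exact h.hit hm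

theorem Extends.stateOk {p : Fin n} {X Y : History n} (h : Extends p X Y) {q : Fin n}
    {s : State n} (hs : StateOk coin F X q s) (haux : ∀ r b, Y.aux q r b → r ∈ s.auxSent) :
    StateOk coin F Y q s where
  bvalRecv r b j h' hj := h.estimate (hs.bvalRecv r b j h' hj)
  auxRecv r b j h' hj := h.aux _ _ _ (hs.auxRecv r b j h' hj)
  finishRecv b j h' hj := h.hit (hs.finishRecv b j h' hj)
  binVals r b h' := h.estimate (hs.binVals r b h')
  auxSent := haux
  vals V h' :=
    let ⟨r, est, h₁, h₂⟩ := hs.vals V h'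
    ⟨r, est, h₁, h.collected _ _ h₂⟩

/-- Only `sendAux` and `collect` add to the history; every other step justifies its effects by what
is already there. -/
theorem Step.extend {p : Fin n} {s s' : State n} {ev : Ev n} {e : Eff n} {X : History n}
    (h : Step n t s ev s' e) (hn : t < n) (hF : F.card ≤ t)
    (hX : X.Sound t coin F) (hs : StateOk coin F X p s)
    (hcoin : ∀ id v, ev = .coin id v → v = coin id)
    (hrecv : ∀ q m, ev = .recv q m → q ∉ F → MsgOk coin X q m) :
    ∃ Y : History n, Extends p X Y ∧ Y.Sound t coin F ∧ StateOk coin F Y p s' ∧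
      (∀ x ∈ e.sends, MsgOk coin Y p x.2) ∧ ∀ b, e.out = some b → Hit coin Y b := by
  -- Each threshold above `t` contains a witness outside `F`, whose message is justified.
  have hcount : ∀ {P : Fin n → Prop} {k : ℕ}, t + 1 ≤ k → k ≤ nodeCount P → ∃ j, j ∉ F ∧ P j :=
    fun h₁ h₂ => exists_of_card_lt_nodeCount (by omega)
  cases h with
  | input b h hc =>
    refine ⟨X, .rfl, hX, { hs with vals := fun V hV => ?_ }, ?_, by simp⟩
    · obtain ⟨r, est, h', -⟩ := hs.vals V hV
      simp [hc] at h'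
    · simp only [toAll, List.mem_map, forall_exists_index, and_imp]
      rintro _ j - rfl
      exact .inl rfl
  | recvBval j r b h =>
    refine ⟨X, .rfl, hX, { hs with bvalRecv := fun r' b' j' hm hj => ?_ }, by simp, by simp⟩
    obtain heq | hm := Finset.mem_insert.1 hm
    · cases heq
      exact hrecv _ _ rfl hj
    · exact hs.bvalRecv _ _ _ hm hj
  | recvAux j r b h hfirst =>
    refine ⟨X, .rfl, hX, { hs with auxRecv := fun r' b' j' hm hj => ?_ }, by simp, by simp⟩
    obtain heq | hm := Finset.mem_insert.1 hm
    · cases heq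
      exact hrecv _ _ rfl hj
    · exact hs.auxRecv _ _ _ hm hj
  | recvFinish j b h hfirst =>
    refine ⟨X, .rfl, hX, { hs with finishRecv := fun b' j' hm hj => ?_ }, by simp, by simp⟩
    obtain heq | hm := Finset.mem_insert.1 hm
    · cases heq
      exact hrecv _ _ rfl hj
    · exact hs.finishRecv _ _ hm hj
  | relayBval r b h hc hs' =>
    obtain ⟨j, hj, hm⟩ := hcount le_rfl hc
    refine ⟨X, .rfl, hX, { hs with }, ?_, by simp⟩
    simp only [toAll, List.mem_map, forall_exists_index, and_imp]
    rintro _ j - rfl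
    exact hs.bvalRecv _ _ _ hm hj
  | addBin r b h hc =>
    obtain ⟨j, hj, hm⟩ := hcount (by omega) hc
    refine ⟨X, .rfl, hX, { hs with binVals := fun r' b' hb => ?_ }, by simp, by simp⟩
    obtain heq | hb := Finset.mem_insert.1 hb
    · cases heq
      exact hs.bvalRecv _ _ _ hm hj
    · exact hs.binVals _ _ hb
  | sendAux r est b h hc hb hs' =>
    let Y : History n :=
      { X with aux := fun j r' b' => X.aux j r' b' ∨ j = p ∧ r' = r ∧ b' = b }
    have hY : Extends p X Y := ⟨fun _ _ h => h, fun _ _ _ h => .inl h,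
      fun j hj r b h => h.resolve_right fun h' => hj h'.1⟩
    have hfresh : ∀ b, ¬ X.aux p r b := fun b h => hs' (hs.auxSent r b h)
    have hs₁ : StateOk coin F X p { s with auxSent := insert r s.auxSent } :=
      { hs with auxSent := fun r b h => Finset.mem_insert_of_mem (hs.auxSent r b h) }
    refine ⟨Y, hY, ⟨fun r V hV => ?_, hX.nonempty, fun r V hV b hb => ?_, ?_⟩,
      hY.stateOk hs₁ ?_, ?_, by simp⟩
    · obtain ⟨Q, hQ, hQ'⟩ := hX.quorum r V hV
      refine ⟨Q, hQ, fun j hj hjF => ?_⟩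
      obtain ⟨b, hb, hb'⟩ := hQ' j hj hjF
      exact ⟨b, hb, .inl hb'⟩
    · exact hX.estimate r V hV b hb
    · rintro j hj r b b' (h₁ | ⟨rfl, rfl, rfl⟩) (h₂ | ⟨h₃, h₄, h₅⟩)
      · exact hX.aux_unique j hj r b b' h₁ h₂
      · subst h₃ h₄
        exact absurd h₁ (hfresh _)
      · exact absurd h₂ (hfresh _)
      · exact h₅.symm
    · rintro r' b' (h' | ⟨-, rfl, -⟩)
      · exact hs₁.auxSent _ _ h'
      · exact Finset.mem_insert_self _ _
    · simp only [toAll, List.mem_map, forall_exists_index, and_imp]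
      rintro _ j - rfl
      exact .inr ⟨rfl, rfl, rfl⟩
  | collect r est Q V h hc hv hs' hQ hQV hVQ hbin =>
    let Y : History n :=
      { X with collected := fun r' V' => X.collected r' V' ∨ r' = r ∧ V' = V }
    have hY : Extends p X Y := ⟨fun _ _ h => .inl h, fun _ _ _ h => h, fun _ _ _ _ h => h⟩
    refine ⟨Y, hY, ⟨?_, ?_, ?_, hX.aux_unique⟩, ?_, by simp, by simp⟩
    · rintro r' V' (h' | ⟨rfl, rfl⟩)
      · exact hX.quorum r' V' h'
      · refine ⟨Q, hQ, fun j hj hjF => ?_⟩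
        obtain ⟨b, hb, hb'⟩ := hQV j hj
        exact ⟨b, hb, hs.auxRecv _ _ _ hb' hjF⟩
    · rintro r' V' (h' | ⟨rfl, rfl⟩)
      · exact hX.nonempty r' V' h'
      -- `t < n` makes the quorum, and thus the collected set, nonempty.
      · obtain ⟨j, hj⟩ : Q.Nonempty := Finset.card_pos.1 (by omega)
        obtain ⟨b, hb, -⟩ := hQV j hj
        exact ⟨b, hb⟩
    · rintro r' V' (h' | ⟨rfl, rfl⟩) b hb
      · exact hY.estimate (hX.estimate r' V' h' b hb)
      · exact hY.estimate (hs.binVals _ _ (hbin b hb))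
    · refine { hY.stateOk hs hs.auxSent with vals := ?_ }
      rintro _ ⟨⟩
      exact ⟨r, est, hc, .inr ⟨rfl, rfl⟩⟩
  | coinMixed r est V b h hc hv hV =>
    obtain ⟨r', est', hc', hcol⟩ := hs.vals V hv
    obtain ⟨rfl, rfl⟩ : r = r' ∧ est = est' := by simpa [hc] using hc'
    refine ⟨X, .rfl, hX, { hs with vals := by simp }, ?_, by simp⟩
    simp only [toAll, List.mem_map, forall_exists_index, and_imp]
    rintro _ j - rfl
    exact .inr ⟨r, V, rfl, hcol, .inr ⟨hV, hcoin _ _ rfl⟩⟩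
  | coinMiss r est b b' h hc hv hb =>
    obtain ⟨r', est', hc', hcol⟩ := hs.vals _ hv
    obtain ⟨rfl, rfl⟩ : r = r' ∧ est = est' := by simpa [hc] using hc'
    refine ⟨X, .rfl, hX, { hs with vals := by simp }, ?_, by simp⟩
    simp only [toAll, List.mem_map, forall_exists_index, and_imp]
    rintro _ j - rfl
    exact .inr ⟨r, _, rfl, hcol, .inl rfl⟩
  | coinHit r est b h hc hv =>
    obtain ⟨r', est', hc', hcol⟩ := hs.vals _ hv
    obtain ⟨rfl, rfl⟩ : r = r' ∧ est = est' := by simpa [hc] using hc'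
    refine ⟨X, .rfl, hX, { hs with vals := by simp }, fun x hx => ?_, by simp⟩
    obtain hx | hx := List.mem_append.1 hx
    · split_ifs at hx
      · simp at hx
      · simp only [toAll, List.mem_map] at hx
        obtain ⟨j, -, rfl⟩ := hx
        exact ⟨r, hcol, (hcoin _ _ rfl).symm⟩
    · simp only [toAll, List.mem_map] at hx
      obtain ⟨j, -, rfl⟩ := hx
      exact .inr ⟨r, _, rfl, hcol, .inl rfl⟩
  | relayFinish b h hc hs' =>
    obtain ⟨j, hj, hm⟩ := hcount le_rfl hc
    refine ⟨X, .rfl, hX, { hs with }, ?_, by simp⟩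
    simp only [toAll, List.mem_map, forall_exists_index, and_imp]
    rintro _ j - rfl
    exact hs.finishRecv _ _ hm hj
  | output b h hc hs' =>
    obtain ⟨j, hj, hm⟩ := hcount (by omega) hc
    refine ⟨X, .rfl, hX, { hs with }, by simp, ?_⟩
    rintro _ ⟨⟩
    exact hs.finishRecv _ _ hm hj

/-- Some history justifies the configuration. -/
def Justified (t : ℕ) (coin : ℕ → Bool) (F : Finset (Fin n)) (c : Config (protocol n t)) : Prop :=
  ∃ X : History n, X.Sound t coin F ∧ (∀ p ∉ F, StateOk coin F X p (c.state p)) ∧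
    (∀ p q m, (p, q, m) ∈ c.net → p ∉ F → MsgOk coin X p m) ∧
    ∀ p b, (p, b) ∈ c.outs → p ∉ F → Hit coin X b

theorem justified_of_reachable (hn : t < n) (hF : F.card ≤ t) {c : Config (protocol n t)}
    (hc : Reachable (protocol n t) t coin c) (hcF : c.corrupted ⊆ F) : Justified t coin F c := by
  refine hc.invariant (F := F) (Inv := Justified t coin F) ?_ (fun _ _ h => h) ?_ hcF
  · refine ⟨⟨fun _ _ => False, fun _ _ _ => False⟩, ⟨?_, ?_, ?_, ?_⟩,
      fun p hp => ⟨?_, ?_, ?_, ?_, ?_, ?_⟩, fun p q m hm => ?_, ?_⟩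
    on_goal 11 => exact absurd hm (Multiset.notMem_zero _)
    all_goals simp [Config.start, protocol]
  · rintro c p ev c₀ s e ⟨X, hX, hst, hnet, hout⟩ hcF hc hs
    -- A node of `F` may not be corrupted yet and still run the program; its steps are nevertheless
    -- left out of the history.
    by_cases hp : p ∈ F
    · refine ⟨X, hX, fun q hq => ?_, fun q r m hm hq => ?_, fun q b hb hq => ?_⟩
      · have : q ≠ p := fun h => hq (h ▸ hp)
        simpa [Config.commit, this, hc.state_eq] using hst q hq
      · obtain hm | ⟨rfl, -⟩ := Config.mem_commit_net.1 hm
        · exact hnet q r m (Multiset.mem_of_le hc.net_le hm) hq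
        · exact absurd hp hq
      · obtain hb | ⟨rfl, -⟩ := Config.mem_commit_outs.1 hb
        · exact hout q b (hc.outs_eq ▸ hb) hq
        · exact absurd hp hq
    · obtain ⟨Y, hXY, hY, hst', hsends, hout'⟩ := Step.extend hs hn hF hX (hst p hp) hc.coin_eq
        fun q m hev hq => hnet q p m ((hc.sender q m hev).resolve_left fun h => hq (hcF h)) hq
      refine ⟨Y, hY, fun q hq => ?_, fun q r m hm hq => ?_, fun q b hb hq => ?_⟩
      · by_cases hqp : q = p
        · subst hqp
          simpa [Config.commit] using hst'
        · have := hXY.stateOk (hst q hq) fun r b h =>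
            (hst q hq).auxSent r b (hXY.aux_of_ne q hqp r b h)
          simpa [Config.commit, hqp, hc.state_eq] using this
      · obtain hm | ⟨rfl, hm'⟩ := Config.mem_commit_net.1 hm
        · exact hXY.msgOk (hnet q r m (Multiset.mem_of_le hc.net_le hm) hq)
        · exact hsends _ hm'
      · obtain hb | ⟨rfl, hb'⟩ := Config.mem_commit_outs.1 hb
        · exact hXY.hit (hout q b (hc.outs_eq ▸ hb) hq)
        · exact hout' b hb'

theorem agreement (hn : 3 * t + 1 ≤ n) : Agreement (protocol n t) t := by
  intro coin c hc p q u v hp hq hu hv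
  obtain ⟨X, hX, -, -, hout⟩ := justified_of_reachable (by omega) hc.card_corrupted_le hc subset_rfl
  exact hX.hit_unique hc.card_corrupted_le hn (hout p u hu hp) (hout q v hv hq)

end ABBA

/-! ## Agreement of the multi-valued Byzantine agreement -/

/-- Messages whose code words agree in `k` symbols are equal. -/
theorem ECC.eq_of_le_nodeCount {n k : ℕ} {W A : Type} (code : ECC n k W A) {w w' : W}
    (h : k ≤ nodeCount fun j => code.enc w j = code.enc w' j) : w = w' := by
  classical
  -- The common symbols form an error-free observation of both code words, so the decoder with `e =
  -- 0` must return both messages.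
  let obs : Fin n → Option A := fun j =>
    if code.enc w j = code.enc w' j then some (code.enc w j) else none
  have hobs : ∀ j y, obs j = some y ↔ code.enc w j = code.enc w' j ∧ code.enc w j = y := by
    intro j y
    simp only [obs]
    split_ifs with h <;> simp [h]
  have hk : 2 * 0 + k ≤ nodeCount fun j => ∃ y, obs j = some y := by
    refine (Nat.le_of_eq (by omega)).trans (h.trans (nodeCount_mono fun j hj => ?_))
    exact ⟨_, (hobs j _).2 ⟨hj, rfl⟩⟩
  have hempty : ∀ v, (v = w ∨ v = w') →
      nodeCount (fun j => ∃ y, obs j = some y ∧ y ≠ code.enc v j) ≤ 0 := by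
    intro v hv
    rw [nodeCount_eq, Nat.le_zero, Finset.card_eq_zero, Finset.filter_eq_empty_iff]
    rintro j - ⟨y, hy, hne⟩
    obtain ⟨h₁, rfl⟩ := (hobs j y).1 hy
    obtain rfl | rfl := hv
    · exact hne rfl
    · exact hne h₁
  rw [← code.dec_correct w obs 0 hk (hempty w (.inl rfl)),
    code.dec_correct w' obs 0 hk (hempty w' (.inr rfl))]

namespace LiChen

variable {n t : ℕ} {W A : Type}

/-! ### Double counting: the message that passes both phases is the most frequent one. -/

section Counting

open Classical in
/-- The positions in which two code words agree. -/
noncomputable def agreeing (code : ECC n (dim t) W A) (w w' : W) : Finset (Fin n) :=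
  Finset.univ.filter fun j => code.enc w j = code.enc w' j

theorem mem_agreeing {code : ECC n (dim t) W A} {w w' : W} {j : Fin n} :
    j ∈ agreeing code w w' ↔ code.enc w j = code.enc w' j := by
  simp [agreeing]

theorem card_agreeing_le (code : ECC n (dim t) W A) {w w' : W} (h : w ≠ w') :
    (agreeing code w w').card ≤ t / 5 := by
  by_contra! hlt
  refine h (code.eq_of_le_nodeCount ?_)
  rw [nodeCount]
  exact hlt

/-- If nodes `i` and `j` have exchanged their symbols, they are linked with each other. -/
def Compatible (code : ECC n (dim t) W A) (m : Fin n → Option W) (i j : Fin n) : Prop :=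
  ∃ w w', m i = some w ∧ m j = some w' ∧ code.enc w i = code.enc w' i ∧
    code.enc w j = code.enc w' j

/-- Here `h` counts the nodes outside `F`, `g` and `g'` those with `w` and `w'`, `ρ` the rest, and
`c`, `b` are the sizes of the sets `C`, `B` in `card_group_lt`. Each node of `C` or `B` has at least
`x` partners outside the group of `w`, and `κ = ⌊t/5⌋` bounds the agreement of different code words.
-/
theorem plurality_arith {t h g g' ρ b c κ x : ℕ} (hh : 4 * t + 1 ≤ h) (hg : g ≤ g')
    (hρ : g + g' + ρ = h) (hκ : 5 * κ ≤ t) (hx : x = h - 2 * t - g) (hc : h - 2 * t ≤ c)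
    (hcx : c * x ≤ (h - g) * κ) (hbx : b * x ≤ ρ * κ) (hcb : c ≤ b + κ + ρ) : False := by
  -- From `2g + ρ ≤ h` and `h ≥ 4t + 1`; in particular the subtraction defining `x` is not
  -- truncated.
  have hx1 : ρ + 1 ≤ 2 * x := by omega
  have hb : b ≤ 2 * κ := by
    refine Nat.le_of_mul_le_mul_right (c := x) (hbx.trans ?_) (by omega)
    nlinarith [Nat.mul_le_mul_right κ (show ρ ≤ 2 * x by omega)]
  -- `h - 2t ≤ c ≤ 3κ + ρ` bounds `ρ` below, and `2x ≥ h - 4t + ρ` then gives `2x ≥ 2t + 2 - 3κ`.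
  have hxt : 7 * t + 10 ≤ 10 * x := by omega
  have hhg : h - g = 2 * t + x := by omega
  rw [hhg] at hcx
  have h₁ : (2 * t + 1) * x ≤ (2 * t + x) * κ := le_trans (Nat.mul_le_mul_right x (by omega)) hcx
  have h₂ : (2 * t + x) * (5 * κ) ≤ (2 * t + x) * t := Nat.mul_le_mul_left _ hκ
  -- The two bounds combine to `9tx + 5x ≤ 2t²`, impossible for `x` above `7t/10`.
  nlinarith [Nat.mul_le_mul_right t hxt]

open Classical in
/-- The nodes outside `F` with message `w`. -/
noncomputable def group (F : Finset (Fin n)) (m : Fin n → Option W) (w : W) : Finset (Fin n) :=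
  Fᶜ.filter fun j => m j = some w

theorem mem_group {F : Finset (Fin n)} {m : Fin n → Option W} {w : W} {j : Fin n} :
    j ∈ group F m w ↔ j ∉ F ∧ m j = some w := by
  simp [group]

/-- The message of a node that succeeds in both phases is more frequent than any other one. -/
theorem card_group_lt (hn : 5 * t + 1 ≤ n) (code : ECC n (dim t) W A) {F : Finset (Fin n)}
    (hF : F.card ≤ t) {m : Fin n → Option W} {S : Fin n → Prop}
    (hS : ∀ j ∉ F, S j → n - 2 * t ≤ nodeCount (fun k => k ∉ F ∧ Compatible code m j k) + F.card)
    {i : Fin n} {w : W} (hw : m i = some w)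
    (hi : n - 2 * t ≤ nodeCount (fun j => j ∉ F ∧ S j ∧ Compatible code m i j) + F.card)
    {w' : W} (hne : w ≠ w') : (group F m w').card < (group F m w).card := by
  classical
  by_contra! hle
  have hFn : Fᶜ.card = n - F.card := by rw [Finset.card_compl, Fintype.card_fin]
  set G := group F m w with hG
  set G' := group F m w' with hG'
  have hGF : G ⊆ Fᶜ := Finset.filter_subset _ _
  have hG'F : G' ⊆ Fᶜ := Finset.filter_subset _ _
  have hdisj : Disjoint G G' := by
    rw [Finset.disjoint_left]
    intro j hj hj'
    exact hne (Option.some.inj ((mem_group.1 hj).2.symm.trans (mem_group.1 hj').2))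
  set R := Fᶜ \ (G ∪ G') with hR
  have hcard : G.card + G'.card + R.card = Fᶜ.card := by
    rw [← Finset.card_union_of_disjoint hdisj, add_comm]
    exact Finset.card_sdiff_add_card_eq_card (Finset.union_subset hGF hG'F)
  -- The nodes outside `F` that support `i` in the first phase. Being compatible with `i`, each
  -- holds a message whose own symbol is that of `w`.
  set C := Fᶜ.filter fun j => S j ∧ Compatible code m i j with hC
  have hCcard : Fᶜ.card - 2 * t ≤ C.card := by
    have : nodeCount (fun j => j ∉ F ∧ S j ∧ Compatible code m i j) = C.card := by
      rw [nodeCount_eq]; congr 1; ext j; simp [C]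
    omega
  have hdeg : ∀ j ∉ F, S j → Fᶜ.card - 2 * t ≤ (Fᶜ.filter (Compatible code m j)).card := by
    intro j hj hSj
    have h₁ := hS j hj hSj
    have : nodeCount (fun k => k ∉ F ∧ Compatible code m j k) =
        (Fᶜ.filter (Compatible code m j)).card := by
      rw [nodeCount_eq]; congr 1; ext j; simp
    omega
  -- a node with another message is compatible with few nodes that share a symbol of `w`
  have hfew : ∀ (B : Finset (Fin n)), (∀ j ∈ B, ∀ v, m j = some v → code.enc w j = code.enc v j) →
      ∀ d ∈ Fᶜ \ G, (B.filter fun j => Compatible code m j d).card ≤ t / 5 := by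
    intro B hB d hd
    obtain ⟨hdF, hdG⟩ := Finset.mem_sdiff.1 hd
    cases hmd : m d with
    | none =>
      refine (Finset.card_eq_zero.2 (Finset.filter_eq_empty_iff.2 ?_)).trans_le (Nat.zero_le _)
      rintro j - ⟨v, v', -, hv', -⟩
      simp [hmd] at hv'
    | some v =>
      have hwv : w ≠ v := by
        rintro rfl
        exact hdG (mem_group.2 ⟨Finset.mem_compl.1 hdF, hmd⟩)
      refine (Finset.card_le_card fun j hj => ?_).trans (card_agreeing_le code hwv)
      obtain ⟨hj, u, u', hu, hu', h₁, -⟩ := Finset.mem_filter.1 hj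
      obtain rfl : v = u' := Option.some.inj (hmd.symm.trans hu')
      exact mem_agreeing.2 ((hB j hj u hu).trans h₁)
  have hCw : ∀ j ∈ C, ∀ v, m j = some v → code.enc w j = code.enc v j := by
    intro j hj v hv
    obtain ⟨u, u', hu, hu', -, h₂⟩ := (Finset.mem_filter.1 hj).2.2
    obtain rfl : w = u := Option.some.inj (hw.symm.trans hu)
    obtain rfl : v = u' := Option.some.inj (hv.symm.trans hu')
    exact h₂
  -- Compatible pairs between `C` and the complement of `G`: many per node of `C` since it succeeded
  -- in the first phase, few per node on the other side by `hfew`.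
  have hCx : C.card * (Fᶜ.card - 2 * t - G.card) ≤ (Fᶜ \ G).card * (t / 5) := by
    refine Finset.card_mul_le_card_mul (Compatible code m) (fun j hj => ?_) (hfew C hCw)
    obtain ⟨hjF, hSj, -⟩ := Finset.mem_filter.1 hj
    have h₁ := hdeg j (Finset.mem_compl.1 hjF) hSj
    have h₂ : Fᶜ.filter (Compatible code m j) ⊆
        Finset.bipartiteAbove (Compatible code m) (Fᶜ \ G) j ∪ G := by
      intro d hd
      by_cases hdG : d ∈ G <;> simp_all [Finset.bipartiteAbove]
    have h₃ := (Finset.card_le_card h₂).trans (Finset.card_union_le _ _)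
    omega
  -- Nodes of `G` whose own symbol separates `w` from `w'`. They are compatible with no node of
  -- `G'`, so all their partners outside `G` lie in `R`.
  set B := (G.filter S) \ agreeing code w w' with hB
  have hBG : ∀ j ∈ B, j ∈ G ∧ S j ∧ code.enc w j ≠ code.enc w' j := by
    intro j hj
    obtain ⟨h₁, h₂⟩ := Finset.mem_sdiff.1 hj
    obtain ⟨h₃, h₄⟩ := Finset.mem_filter.1 h₁
    exact ⟨h₃, h₄, fun h => h₂ (mem_agreeing.2 h)⟩
  have hBx : B.card * (Fᶜ.card - 2 * t - G.card) ≤ R.card * (t / 5) := by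
    refine Finset.card_mul_le_card_mul (Compatible code m) (fun j hj => ?_) fun d hd => ?_
    · obtain ⟨hjG, hSj, hj'⟩ := hBG j hj
      have h₁ := hdeg j (mem_group.1 hjG).1 hSj
      have h₂ : Fᶜ.filter (Compatible code m j) ⊆
          Finset.bipartiteAbove (Compatible code m) R j ∪ G := by
        intro d hd
        obtain ⟨hdF, hd⟩ := Finset.mem_filter.1 hd
        have hdG' : d ∉ G' := by
          intro hdG'
          obtain ⟨u, u', hu, hu', h₁, -⟩ := hd
          obtain rfl : w = u := Option.some.inj ((mem_group.1 hjG).2.symm.trans hu)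
          obtain rfl : w' = u' := Option.some.inj ((mem_group.1 hdG').2.symm.trans hu')
          exact hj' h₁
        by_cases hdG : d ∈ G <;> simp_all [Finset.bipartiteAbove]
      have h₃ := (Finset.card_le_card h₂).trans (Finset.card_union_le _ _)
      omega
    · refine hfew B (fun j hj v hv => ?_) d ?_
      · obtain rfl : w = v := Option.some.inj ((mem_group.1 (hBG j hj).1).2.symm.trans hv)
        rfl
      · exact Finset.sdiff_subset_sdiff le_rfl Finset.subset_union_left hd
  -- A node of `C` in `G'` shares its symbol with `w`, so it sits at an agreeing position of `w` and
  -- `w'`.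
  have hCB : C.card ≤ B.card + t / 5 + R.card := by
    have hsub : C ⊆ B ∪ agreeing code w w' ∪ R := by
      intro j hj
      obtain ⟨hjF, hSj, -⟩ := Finset.mem_filter.1 hj
      by_cases hja : j ∈ agreeing code w w'
      · simp [hja]
      · have hjG' : j ∉ G' := fun h => hja (mem_agreeing.2 (hCw j hj _ (mem_group.1 h).2))
        by_cases hjG : j ∈ G
        · simp [B, hja, hjG, hSj]
        · simp only [R, Finset.mem_union, Finset.mem_sdiff]
          tauto
    have h₁ := (Finset.card_le_card hsub).trans (Finset.card_union_le _ _)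
    have h₂ := Finset.card_union_le B (agreeing code w w')
    have h₃ := card_agreeing_le code hne
    omega
  rw [Finset.card_sdiff_of_subset hGF] at hCx
  exact plurality_arith (by omega) hle hcard (Nat.mul_div_le t 5) rfl hCcard hCx hBx hCB

end Counting

/-! ### The binary agreement decides between a message and the default value. -/

section Binary

variable {code : ECC n (dim t) W A}

/-- The binary agreement. -/
def abbaInstance (t : ℕ) (code : ECC n (dim t) W A) :
    Subprotocol (protocol n t code) (ABBA.protocol n t) where
  msg m := match m with
    | .abba m' => some m'
    | _ => none
  coinId := some
  state s := s.abba
  started s := s.voted = true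
  out s := s.abbaOut

theorem sends_lift (e : ABBA.Eff n) :
    (abbaInstance t code).sends (lift (W := W) (A := A) e).sends = e.sends :=
  Subprotocol.sends_map_self (E := abbaInstance t code) Msg.abba (fun _ => rfl) e.sends

theorem toss_lift (e : ABBA.Eff n) :
    (lift (W := W) (A := A) e).toss.filterMap (abbaInstance t code).coinId = e.toss :=
  List.filterMap_some

theorem sends_toAll (m : Msg A) (h : (abbaInstance t code).msg m = none) :
    (abbaInstance t code).sends (toAll m) = [] :=
  Subprotocol.sends_map_eq_nil (P := protocol n t code) _ (fun _ => h) _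

theorem idle_of_eq {s s' : State n W A} {ev : Ev n W A} {e : Eff n W A}
    (hev : (abbaInstance t code).Foreign ev) (habba : s'.abba = s.abba)
    (hout : s'.abbaOut = s.abbaOut) (hvoted : s'.voted = s.voted)
    (hsends : (abbaInstance t code).sends e.sends = []) (htoss : e.toss = []) :
    (abbaInstance t code).Idle s ev s' e where
  foreign := hev
  state_eq := habba
  out_eq := hout
  started h := hvoted.trans h
  sends_eq := hsends
  toss_eq := by rw [htoss]; rfl

theorem idle_or_active {coin : ℕ → Bool} (p : Fin n) (s : State n W A) (ev : Ev n W A)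
    (s' : State n W A) (e : Eff n W A) (h : Step n t code p s ev s' e)
    (hcoin : ∀ id v, ev = .coin id v → v = coin id) :
    (abbaInstance t code).Idle s ev s' e ∨
    ∃ ev' e', (abbaInstance t code).Active coin p s ev s' e ev' e' := by
  cases h with
  | input w h hw =>
    exact .inl (idle_of_eq trivial rfl rfl rfl
      (Subprotocol.sends_map_eq_nil (P := protocol n t code) _ (fun _ => rfl) _) rfl)
  | recvSymbol | recvSi1 | recvSi2 | recvCorrect => exact .inl (idle_of_eq rfl rfl rfl rfl rfl rfl)
  | si1One | si1Zero | si2One | si2Zero | sendCorrect =>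
    exact .inl (idle_of_eq trivial rfl rfl rfl (sends_toAll _ rfl) rfl)
  | outputDefault | outputOwn | outputDecoded =>
    exact .inl (idle_of_eq trivial rfl rfl rfl rfl rfl)
  | voteOne a e h hv hn ha | voteZero a e h hv hn ha =>
    exact .inr ⟨_, e, .input _ (by simp [abbaInstance, hv]), ha, rfl, fun _ => rfl,
      fun _ _ => rfl, sends_lift e, toss_lift e⟩
  | abbaRecv j m a e h ha =>
    exact .inr ⟨.recv j m, e,
      Subprotocol.Corresponds.recv (P := protocol n t code) (Q := ABBA.protocol n t) j _ m rfl, ha,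
      rfl, fun h => h, by simp, sends_lift e, toss_lift e⟩
  | abbaCoin r b a e h ha =>
    obtain rfl := hcoin _ _ rfl
    exact .inr ⟨.coin r (coin r), e,
      Subprotocol.Corresponds.coin (P := protocol n t code) (Q := ABBA.protocol n t) r _ r rfl, ha,
      rfl, fun h => h, by simp, sends_lift e, toss_lift e⟩
  | abbaTau a e h ha =>
    exact .inr ⟨_, e, .tau, ha, rfl, fun h => h, by simp, sends_lift e, toss_lift e⟩

theorem Step.abbaOut_of_out {p : Fin n} {s s' : State n W A} {ev : Ev n W A} {e : Eff n W A}
    (h : Step n t code p s ev s' e) {v : Option W} (hv : e.out = some v) :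
    s.abbaOut = some v.isSome := by
  cases h with
  | outputDefault w h ha hw => cases hv; exact ha
  | outputOwn w h ha h2 hw => cases hv; exact ha
  | outputDecoded v w h ha => cases hv; exact ha
  | _ => simp [lift] at hv

/-- Whether a node outputs a message or the default value is decided by the binary agreement. -/
theorem exists_abba {coin : ℕ → Bool} {c : Config (protocol n t code)}
    (h : Reachable (protocol n t code) t coin c) :
    ∃ d : Config (ABBA.protocol n t), Reachable (ABBA.protocol n t) t coin d ∧
      (abbaInstance t code).View c d ∧ ∀ p v, (p, v) ∈ c.outs → (p, v.isSome) ∈ d.outs := by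
  induction h with
  | refl =>
    exact ⟨Config.start _, .refl, Subprotocol.view_start rfl rfl,
      fun p v hv => by simp [Config.start] at hv⟩
  | tail _ hs ih =>
    obtain ⟨d, hd, hview, hout⟩ := ih
    obtain ⟨d', hd', hview', hsub⟩ := hview.execStep (idle_or_active (coin := coin)) hs hd
    refine ⟨d', hd', hview', ?_⟩
    obtain ⟨p, ev, c₀, s, e, -, hc, hst, rfl⟩ | ⟨p, -, rfl⟩ := hs.consumes_or_corrupt
    · intro q v hv
      obtain hv | ⟨rfl, he⟩ := Config.mem_commit_outs.1 hv
      · exact hsub _ (hout q v (hc.outs_eq ▸ hv))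
      · exact hsub _ (hview.outs _ _ (Step.abbaOut_of_out hst he))
    · exact fun q v hv => hsub _ (hout q v hv)

end Binary

/-! ### Invariants of the coded exchange, and uniqueness of the kept message. -/

section Coded

variable {code : ECC n (dim t) W A} {F : Finset (Fin n)}

/-- What a node keeps once it has it. -/
structure Le (s s' : State n W A) : Prop where
  msg : ∀ w, s.msg = some w → s'.msg = some w
  symRecv : ∀ j yz, s.symRecv j = some yz → s'.symRecv j = some yz
  si1Recv : ∀ j b, s.si1Recv j = some b → s'.si1Recv j = some b
  si1Sent : ∀ b, s.si1Sent = some b → s'.si1Sent = some b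
  si2Sent : ∀ b, s.si2Sent = some b → s'.si2Sent = some b

theorem Le.of_eq {s s' : State n W A} (h₁ : s'.msg = s.msg) (h₂ : s'.symRecv = s.symRecv)
    (h₃ : s'.si1Recv = s.si1Recv) (h₄ : s'.si1Sent = s.si1Sent) (h₅ : s'.si2Sent = s.si2Sent) :
    Le s s' := by
  constructor <;> simp_all

theorem Step.le {p : Fin n} {s s' : State n W A} {ev : Ev n W A} {e : Eff n W A}
    (h : Step n t code p s ev s' e) : Le s s' := by
  have hupd : ∀ {α : Type} (f : Fin n → Option α) (j : Fin n) (a : α), f j = none →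
      ∀ j' b, f j' = some b → Function.update f j (some a) j' = some b := by
    intro α f j a hj j' b hb
    rw [Function.update_of_ne, hb]
    rintro rfl
    simp [hj] at hb
  cases h with
  | input w h hw => exact { Le.of_eq (s := s) rfl rfl rfl rfl rfl with msg := by simp [hw] }
  | recvSymbol j y z h hfirst =>
    exact { Le.of_eq (s := s) rfl rfl rfl rfl rfl with symRecv := hupd _ _ _ hfirst }
  | recvSi1 j b h hfirst =>
    exact { Le.of_eq (s := s) rfl rfl rfl rfl rfl with si1Recv := hupd _ _ _ hfirst }
  | si1One h hs | si1Zero h hs =>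
    exact { Le.of_eq (s := s) rfl rfl rfl rfl rfl with si1Sent := by simp [hs] }
  | si2One h hs | si2Zero h hs =>
    exact { Le.of_eq (s := s) rfl rfl rfl rfl rfl with si2Sent := by simp [hs] }
  | _ => exact .of_eq rfl rfl rfl rfl rfl

theorem Le.linked {s s' : State n W A} (h : Le s s') {i j : Fin n} (hl : Linked code i s j) :
    Linked code i s' j :=
  let ⟨w, h₁, h₂⟩ := hl
  ⟨w, h.msg w h₁, h.symRecv j _ h₂⟩

/-- The symbol `y` at position `j` is that of the message of a node outside `F` that has sent the
second indicator `1`. -/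
def Kept (code : ECC n (dim t) W A) (F : Finset (Fin n)) (st : Fin n → State n W A) (j : Fin n)
    (y : A) : Prop :=
  ∃ k ∉ F, (st k).si2Sent = some true ∧ ∃ w, (st k).msg = some w ∧ y = code.enc w j

/-- The state of the sender `p` justifies a message to `q`. -/
def MsgOk (code : ECC n (dim t) W A) (F : Finset (Fin n)) (st : Fin n → State n W A)
    (p q : Fin n) : Msg A → Prop
  | .symbol y z => ∃ w, (st p).msg = some w ∧ y = code.enc w q ∧ z = code.enc w p
  | .si1 b => (st p).si1Sent = some b
  | .si2 b => (st p).si2Sent = some b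
  | .correct y => Kept code F st p y
  | .abba _ => True

theorem Kept.mono {st st' : Fin n → State n W A} (h : ∀ p, Le (st p) (st' p)) {j : Fin n} {y : A}
    (hy : Kept code F st j y) : Kept code F st' j y :=
  let ⟨k, hk, h₁, w, h₂, h₃⟩ := hy
  ⟨k, hk, (h k).si2Sent _ h₁, w, (h k).msg w h₂, h₃⟩

theorem MsgOk.mono {st st' : Fin n → State n W A} (h : ∀ p, Le (st p) (st' p)) {p q : Fin n}
    {m : Msg A} (hm : MsgOk code F st p q m) : MsgOk code F st' p q m := by
  cases m with
  | symbol y z => exact hm.imp fun w hw => ⟨(h p).msg w hw.1, hw.2⟩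
  | si1 b => exact (h p).si1Sent b hm
  | si2 b => exact (h p).si2Sent b hm
  | correct y => exact Kept.mono h hm
  | abba m => trivial

/-- The indicators that a node has sent are justified by its state. -/
structure SentOk (code : ECC n (dim t) W A) (i : Fin n) (s : State n W A) : Prop where
  si1Sent : s.si1Sent = some true → n - 2 * t ≤ nodeCount (Linked code i s)
  si2Sent : s.si2Sent = some true → n - 2 * t ≤ nodeCount (Succ code i s s.si1Recv)

theorem Step.sentOk {p : Fin n} {s s' : State n W A} {ev : Ev n W A} {e : Eff n W A}
    (h : Step n t code p s ev s' e) (hs : SentOk code p s) : SentOk code p s' := by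
  have h₁ : s.si1Sent = some true → n - 2 * t ≤ nodeCount (Linked code p s') := fun h' =>
    (hs.si1Sent h').trans (nodeCount_mono fun j => h.le.linked)
  have h₂ : s.si2Sent = some true → n - 2 * t ≤ nodeCount (Succ code p s' s'.si1Recv) := fun h' =>
    (hs.si2Sent h').trans
      (nodeCount_mono fun j hj => ⟨h.le.si1Recv j _ hj.1, h.le.linked hj.2⟩)
  cases h with
  | si1One h hs hn => exact ⟨fun _ => hn, h₂⟩
  | si1Zero h hs hn => exact ⟨by simp, h₂⟩
  | si2One h hs h1 hn => exact ⟨h₁, fun _ => hn⟩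
  | si2Zero h hs hn => exact ⟨h₁, by simp⟩
  | _ => exact ⟨h₁, h₂⟩

/-- What a node has received from nodes outside `F` is justified by their states. -/
structure RecvOk (code : ECC n (dim t) W A) (F : Finset (Fin n)) (st : Fin n → State n W A)
    (i : Fin n) (s : State n W A) : Prop where
  symRecv : ∀ j ∉ F, ∀ yz, s.symRecv j = some yz → MsgOk code F st j i (.symbol yz.1 yz.2)
  si1Recv : ∀ j ∉ F, ∀ b, s.si1Recv j = some b → MsgOk code F st j i (.si1 b)
  si2Recv : ∀ j ∉ F, ∀ b, s.si2Recv j = some b → MsgOk code F st j i (.si2 b)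
  correctRecv : ∀ j ∉ F, ∀ y, s.correctRecv j = some y → MsgOk code F st j i (.correct y)

theorem RecvOk.mono {st st' : Fin n → State n W A} (h : ∀ p, Le (st p) (st' p)) {i : Fin n}
    {s : State n W A} (hs : RecvOk code F st i s) : RecvOk code F st' i s where
  symRecv j hj yz h' := (hs.symRecv j hj yz h').mono h
  si1Recv j hj b h' := (hs.si1Recv j hj b h').mono h
  si2Recv j hj b h' := (hs.si2Recv j hj b h').mono h
  correctRecv j hj y h' := (hs.correctRecv j hj y h').mono h

/-- One of the `t + 1` reporting nodes is outside `F`, and the first entry of its pair is the symbol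
of its message at position `i`. -/
theorem RecvOk.kept_of_majority {st : Fin n → State n W A} {i : Fin n} {s : State n W A}
    (hs : RecvOk code F st i s) (hF : F.card ≤ t) {y : A}
    (hn : t + 1 ≤ nodeCount fun j => s.si2Recv j = some true ∧ ∃ z, s.symRecv j = some (y, z)) :
    Kept code F st i y := by
  obtain ⟨j, hj, h₁, z, h₂⟩ :=
    exists_of_card_lt_nodeCount (lt_of_lt_of_le (Nat.lt_succ_of_le hF) hn)
  obtain ⟨w, h₃, h₄, -⟩ := hs.symRecv j hj _ h₂
  exact ⟨j, hj, hs.si2Recv j hj _ h₁, w, h₃, h₄⟩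

theorem RecvOk.kept_of_symbols {st : Fin n → State n W A} {i : Fin n} {s : State n W A}
    (hs : RecvOk code F st i s) {j : Fin n} (hj : j ∉ F) {y : A} (hy : symbols s j = some y) :
    Kept code F st j y := by
  unfold symbols at hy
  split_ifs at hy with h
  · obtain ⟨yz, h₁, rfl⟩ := Option.map_eq_some_iff.1 hy
    obtain ⟨w, h₂, -, h₃⟩ := hs.symRecv j hj _ h₁
    exact ⟨j, hj, hs.si2Recv j hj _ h.1, w, h₂, h₃⟩
  · exact hs.correctRecv j hj _ hy

theorem Step.recvOk {p : Fin n} {st : Fin n → State n W A} {s s' : State n W A} {ev : Ev n W A}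
    {e : Eff n W A} (h : Step n t code p s ev s' e)
    (hrecv : ∀ q m, ev = .recv q m → q ∉ F → MsgOk code F st q p m)
    (hs : RecvOk code F st p s) : RecvOk code F st p s' := by
  have hupd : ∀ {α : Type} (f : Fin n → Option α) (j : Fin n) (a : α) (m : α → Msg A),
      (∀ j ∉ F, ∀ b, f j = some b → MsgOk code F st j p (m b)) →
      (j ∉ F → MsgOk code F st j p (m a)) →
      ∀ k ∉ F, ∀ b, Function.update f j (some a) k = some b → MsgOk code F st k p (m b) := by
    intro α f j a m hf ha k hk b hb
    by_cases hkj : k = j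
    · subst hkj
      rw [Function.update_self] at hb
      cases hb
      exact ha hk
    · exact hf k hk b (by rwa [Function.update_of_ne hkj] at hb)
  cases h with
  | recvSymbol j y z h hfirst =>
    exact { hs with
      symRecv := hupd _ _ _ (fun yz : A × A => .symbol yz.1 yz.2) hs.symRecv (hrecv _ _ rfl) }
  | recvSi1 j b h hfirst =>
    exact { hs with si1Recv := hupd _ _ _ .si1 hs.si1Recv (hrecv _ _ rfl) }
  | recvSi2 j b h hfirst =>
    exact { hs with si2Recv := hupd _ _ _ .si2 hs.si2Recv (hrecv _ _ rfl) }
  | recvCorrect j y h hfirst =>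
    exact { hs with correctRecv := hupd _ _ _ .correct hs.correctRecv (hrecv _ _ rfl) }
  | _ => exact { hs with }

/-- Node `p` outputs its own message, or one that shares enough symbols with kept messages. -/
def OutOk (code : ECC n (dim t) W A) (F : Finset (Fin n)) (st : Fin n → State n W A) (p : Fin n)
    (w : W) : Prop :=
  ((st p).si2Sent = some true ∧ (st p).msg = some w) ∨
  dim t ≤ nodeCount fun j => Kept code F st j (code.enc w j)

theorem OutOk.mono {st st' : Fin n → State n W A} (h : ∀ p, Le (st p) (st' p)) {p : Fin n} {w : W}
    (hw : OutOk code F st p w) : OutOk code F st' p w :=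
  hw.imp (fun h' => ⟨(h p).si2Sent _ h'.1, (h p).msg w h'.2⟩)
    fun h' => h'.trans (nodeCount_mono fun _ => Kept.mono h)

/-- For a decoded output only the final check matters: of `dim t + t` agreeing symbols, at least
`dim t` come from nodes outside `F`. -/
theorem Step.outOk {p : Fin n} {st : Fin n → State n W A} {s' : State n W A} {ev : Ev n W A}
    {e : Eff n W A} (h : Step n t code p (st p) ev s' e) (hF : F.card ≤ t)
    (hs : RecvOk code F st p (st p)) {w : W} (hw : e.out = some (some w)) :
    OutOk code F st p w := by
  cases h with
  | outputDefault w h ha hw' => cases hw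
  | outputOwn w h ha h2 hw' => cases hw; exact .inl ⟨h2, hw'⟩
  | outputDecoded v w h ha hv h2 hs' hw' hn =>
    cases hw
    refine .inr ?_
    have h₁ := nodeCount_le_add_card (fun j => symbols (st p) j = some (code.enc w j)) F
    have h₂ : dim t ≤ nodeCount fun j => j ∉ F ∧ symbols (st p) j = some (code.enc w j) := by omega
    exact h₂.trans (nodeCount_mono fun j hj => hs.kept_of_symbols hj.1 hj.2)
  | _ => simp [lift] at hw

/-- The states are those after the step, since a message or indicator being sent is recorded only
then. -/
theorem Step.sendsOk {p : Fin n} {st : Fin n → State n W A} {s' : State n W A} {ev : Ev n W A}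
    {e : Eff n W A} (h : Step n t code p (st p) ev s' e) (hF : F.card ≤ t)
    (hs : RecvOk code F st p (st p)) {q : Fin n} {m : Msg A} (hm : (q, m) ∈ e.sends) :
    MsgOk code F (Function.update st p s') p q m := by
  have hle : ∀ k, Le (st k) (Function.update st p s' k) := by
    intro k
    by_cases hk : k = p
    · subst hk
      simpa using h.le
    · simpa [hk] using Le.of_eq (s := st k) rfl rfl rfl rfl rfl
  cases h with
  | input w h hw =>
    simp only [List.mem_map, Prod.mk.injEq] at hm
    obtain ⟨j, -, rfl, rfl⟩ := hm
    exact ⟨w, by simp, rfl, rfl⟩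
  | si1One | si1Zero | si2One | si2Zero =>
    simp only [toAll, List.mem_map, Prod.mk.injEq] at hm
    obtain ⟨j, -, rfl, rfl⟩ := hm
    simp [MsgOk]
  | sendCorrect y h ha h2 hs' hn =>
    simp only [toAll, List.mem_map, Prod.mk.injEq] at hm
    obtain ⟨j, -, rfl, rfl⟩ := hm
    exact Kept.mono hle (hs.kept_of_majority hF hn)
  | voteOne | voteZero | abbaRecv | abbaCoin | abbaTau =>
    simp only [lift, List.mem_map, Prod.mk.injEq] at hm
    obtain ⟨x, -, rfl, rfl⟩ := hm
    trivial
  | _ => simp at hm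

/-- The states of the nodes outside `F` justify what they have sent and output. -/
structure Justified (code : ECC n (dim t) W A) (F : Finset (Fin n))
    (c : Config (protocol n t code)) : Prop where
  sent : ∀ p ∉ F, SentOk code p (c.state p)
  recv : ∀ p ∉ F, RecvOk code F c.state p (c.state p)
  net : ∀ p q m, (p, q, m) ∈ c.net → p ∉ F → MsgOk code F c.state p q m
  outs : ∀ p w, (p, some w) ∈ c.outs → p ∉ F → OutOk code F c.state p w

theorem justified_of_reachable {coin : ℕ → Bool} (hF : F.card ≤ t)
    {c : Config (protocol n t code)} (hc : Reachable (protocol n t code) t coin c)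
    (hcF : c.corrupted ⊆ F) : Justified code F c := by
  refine hc.invariant (F := F) (Inv := Justified code F) ?_ (fun _ _ h => ⟨h.1, h.2, h.3, h.4⟩)
    ?_ hcF
  · refine ⟨fun p hp => ⟨?_, ?_⟩, fun p hp => ⟨?_, ?_, ?_, ?_⟩,
      fun p q m hm => absurd hm (Multiset.notMem_zero _), ?_⟩ <;> simp [Config.start, protocol]
  · rintro c p ev c₀ s e ⟨hsent, hrecv, hnet, hout⟩ hcF hc hs
    have hst : (c₀.commit p s e).state = Function.update c.state p s := by
      simp [Config.commit, hc.state_eq]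
    have hle : ∀ k, Le (c.state k) ((c₀.commit p s e).state k) := by
      intro k
      rw [hst]
      by_cases hk : k = p
      · subst hk
        simpa using Step.le hs
      · simpa [hk] using Le.of_eq (s := c.state k) rfl rfl rfl rfl rfl
    refine ⟨fun q hq => ?_, fun q hq => ?_, fun q r m hm hq => ?_, fun q w hw hq => ?_⟩
    · rw [hst]
      by_cases hqp : q = p
      · subst hqp
        simpa using Step.sentOk hs (hsent q hq)
      · simpa [hqp] using hsent q hq
    · by_cases hqp : q = p
      · subst hqp
        have := Step.recvOk hs (fun k m hev hk =>
          hnet k q m ((hc.sender k m hev).resolve_left fun h => hk (hcF h)) hk) (hrecv q hq)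
        simpa [hst] using this.mono hle
      · simpa [hst, hqp] using (hrecv q hq).mono hle
    · obtain hm | ⟨rfl, hm'⟩ := Config.mem_commit_net.1 hm
      · exact (hnet q r m (Multiset.mem_of_le hc.net_le hm) hq).mono hle
      · rw [hst]
        exact Step.sendsOk hs hF (hrecv q hq) hm'
    · obtain hw | ⟨rfl, hw'⟩ := Config.mem_commit_outs.1 hw
      · exact (hout q w (hc.outs_eq ▸ hw) hq).mono hle
      · exact (Step.outOk hs hF (hrecv q hq) hw').mono hle

/-- Turns the local observation of a link into a symmetric relation between the two messages, the
form needed for counting. -/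
theorem Justified.compatible {c : Config (protocol n t code)} (h : Justified code F c) {i j : Fin n}
    (hi : i ∉ F) (hj : j ∉ F) (hl : Linked code i (c.state i) j) :
    Compatible code (fun k => (c.state k).msg) i j := by
  obtain ⟨w, h₁, h₂⟩ := hl
  obtain ⟨w', h₃, h₄, h₅⟩ := (h.recv i hi).symRecv j hj _ h₂
  exact ⟨w, w', h₁, h₃, h₄, h₅⟩

/-- Nodes that have sent the second indicator `1` have the same message. -/
theorem Justified.msg_unique (hn : 5 * t + 1 ≤ n) (hF : F.card ≤ t)
    {c : Config (protocol n t code)} (h : Justified code F c) {i i' : Fin n} (hi : i ∉ F)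
    (hi' : i' ∉ F) (hs : (c.state i).si2Sent = some true) (hs' : (c.state i').si2Sent = some true)
    {w w' : W} (hw : (c.state i).msg = some w) (hw' : (c.state i').msg = some w') : w = w' := by
  by_contra hne
  -- `S` is the set of nodes with first indicator `1`; at most `F.card` of the nodes counted at a
  -- threshold lie in `F`.
  have hlt : ∀ {i : Fin n} {w w' : W}, i ∉ F → (c.state i).si2Sent = some true →
      (c.state i).msg = some w → w ≠ w' →
      (group F (fun k => (c.state k).msg) w').card <
        (group F (fun k => (c.state k).msg) w).card := by
    intro i w w' hi hs hw hne
    refine card_group_lt hn code hF (S := fun j => (c.state j).si1Sent = some true)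
      (fun j hj hSj => ?_) hw ?_ hne
    · refine (((h.sent j hj).si1Sent hSj).trans (nodeCount_le_add_card _ F)).trans
        (Nat.add_le_add_right (nodeCount_mono fun k hk => ?_) _)
      exact ⟨hk.1, h.compatible hj hk.1 hk.2⟩
    · refine (((h.sent i hi).si2Sent hs).trans (nodeCount_le_add_card _ F)).trans
        (Nat.add_le_add_right (nodeCount_mono fun k hk => ?_) _)
      exact ⟨hk.1, (h.recv i hi).si1Recv k hk.1 _ hk.2.1, h.compatible hi hk.1 hk.2.2⟩
  exact lt_asymm (hlt hi hs hw hne) (hlt hi' hs' hw' (Ne.symm hne))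

/-- Every output message is the message of a node that has sent the second indicator `1`. -/
theorem Justified.exists_of_out (hn : 5 * t + 1 ≤ n) (hF : F.card ≤ t) {c : Config (protocol n t code)}
    (h : Justified code F c) {p : Fin n} (hp : p ∉ F) {u : W} (hu : (p, some u) ∈ c.outs) :
    ∃ i ∉ F, (c.state i).si2Sent = some true ∧ (c.state i).msg = some u := by
  obtain hu | hu := h.outs p u hu hp
  · exact ⟨p, hp, hu⟩
  -- Since `dim t ≥ 1`, some kept symbol exists and names a kept message `w`.
  · have hpos : (∅ : Finset (Fin n)).card < nodeCount fun j =>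
        Kept code F c.state j (code.enc u j) := lt_of_lt_of_le (Nat.succ_pos _) hu
    obtain ⟨j, -, i, hi, hs, w, hw, -⟩ := exists_of_card_lt_nodeCount hpos
    -- All kept symbols belong to the unique kept message, so `u` and `w` share `dim t` symbols.
    obtain rfl : u = w := by
      refine code.eq_of_le_nodeCount (hu.trans (nodeCount_mono fun k hk => ?_))
      obtain ⟨i', hi', hs', w', hw', he⟩ := hk
      rwa [h.msg_unique hn hF hi hi' hs hs' hw hw']
    exact ⟨i, hi, hs, hw⟩

/-- The binary agreement excludes a message against the default value; two messages are both the
unique kept one. -/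
theorem agreement (hn : 5 * t + 1 ≤ n) (code : ECC n (dim t) W A) :
    Agreement (protocol n t code) t := by
  intro coin c hc p q u v hp hq hu hv
  have hF := hc.card_corrupted_le
  have hJ := justified_of_reachable hF hc subset_rfl
  obtain ⟨d, hd, hview, hout⟩ := exists_abba hc
  have hbit : u.isSome = v.isSome := ABBA.agreement (by omega) coin d hd p q _ _
    (hview.corrupted_eq ▸ hp) (hview.corrupted_eq ▸ hq) (hout p u hu) (hout q v hv)
  cases u with
  | none => cases v with
    | none => rfl
    | some v => simp at hbit
  | some u => cases v with
    | none => simp at hbit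
    | some v =>
      obtain ⟨i, hi, hs, hw⟩ := hJ.exists_of_out hn hF hp hu
      obtain ⟨i', hi', hs', hw'⟩ := hJ.exists_of_out hn hF hq hv
      rw [hJ.msg_unique hn hF hi hi' hs hs' hw hw']

end Coded

end LiChen

/-- Agreement of OciorMVBA-RR-IT for `n ≥ 5 t + 1`, with the Byzantine agreement protocol for
`n ≥ 5 t + 1` built above, and more generally with any protocol in its place whose honest nodes
never output different values. -/
theorem mainTheorem4 (n t : ℕ) (hn : 5 * t + 1 ≤ n) (W A B : Type) (pred : W → Bool)
    (code : ECC n (t + 1) W A) (abaCode : ECC n (LiChen.dim t) W B) :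
    Agreement (MVBARR.protocol n t pred code (LiChen.protocol n t abaCode)) t ∧
    ∀ aba : Protocol n W (Option W), Agreement aba t →
      Agreement (MVBARR.protocol n t pred code aba) t := by
  exact ⟨MVBARR.agreement (LiChen.agreement hn abaCode), fun _ h => MVBARR.agreement h⟩
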